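/- Let $d\in\{2,3\}$ and let $\Omega\subset\mathbb R^d$ be a non-empty bounded open set with Lipschitz boundary. Let $H^1_0(\Omega)$ be the closure of $C_c^\infty(\Omega)$ in $H^1(\Omega)$, $\boldsymbol X=\{\boldsymbol v\in H_0^1(\Omega)^d:\operatorname{div}\boldsymbol v=0\}$ (with the $H^1$-norm $\|\cdot\|_{1,\Omega}$), and let $\boldsymbol X^*$ and $[H^{-1}(\Omega)]^2$ be the duals of $\boldsymbol X$ and $[H^1_0(\Omega)]^2$, with dual norms $\|\cdot\|_{\boldsymbol X^*}$ and $\|\cdot\|_{-1,\Omega}$. For $0<\sigma<1$, $H^{1+\sigma}(\Omega)$ carries the norm $\|w\|_{1+\sigma,\Omega}^2=\|w\|_{1,\Omega}^2+\sum_i\iint_{\Omega\times\Omega}\frac{|\partial_iw(x)-\partial_iw(y)|^2}{|x-y|^{d+2\sigma}}\,dx\,dy$; norms of vector fields are the Euclidean combinations of those of the components. Data. $\boldsymbol K$ is a measurable, symmetric, uniformly positive definite $d\times d$ matrix field on $\Omega$ with $\boldsymbol v^\top\boldsymbol K^{-1}(x)\boldsymbol v\ge\alpha_1|\boldsymbol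 v|^2$ for some $\alpha_1>0$; $\nu\in C^2(\mathbb R)$ with $0<\nu_1\le\nu\le\nu_2$, $|\nu_T|\le C_{\nu_T}$ and bounded second derivative, where $\nu_T=\nu'$; $\boldsymbol F\in C^2(\mathbb R^2;\mathbb R^d)$ with $\|\boldsymbol F_{\boldsymbol y}\|\le C_{F_{\boldsymbol y}}$ and bounded second derivative, where $\boldsymbol F_{\boldsymbol y}$ is the derivative of $\boldsymbol F$; $\boldsymbol D$ is a constant real $2\times2$ matrix with $\boldsymbol s^\top\boldsymbol D\boldsymbol s\ge\alpha_2|\boldsymbol s|^2$ for some $\alpha_2>0$. For $\boldsymbol y=(T,S)$ put $$a(\boldsymbol y;\boldsymbol u,\boldsymbol v)=(\boldsymbol K^{-1}\boldsymbol u,\boldsymbol v)+(\nu(T)\nabla\boldsymbol u,\nabla\boldsymbol v),\quad c(\boldsymbol w,\boldsymbol u,\boldsymbol v)=((\boldsymbol w\cdot\nabla)\boldsymbol u,\boldsymbol v),$$ $$a_{\boldsymbol y}(\boldsymbol y,\boldsymbol s)=(\boldsymbol D\nabla\boldsymbol y,\nabla\boldsymbol s),\quad c_{\boldsymbol y}(\boldsymbol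 v,\boldsymbol y,\boldsymbol s)=((\boldsymbol v\cdot\nabla)\boldsymbol y,\boldsymbol s).$$ Constants. Let $0<\delta<\tfrac12$, $p_1=\frac{2d}{d-1-2\delta}$ (that is, $\frac4{1-2\delta}$ if $d=2$ and $\frac3{1-\delta}$ if $d=3$) and $\frac1{p_1}+\frac1{p_2}=\frac12$. Let $C_{p_d}$ be the best constant in $\|\boldsymbol w\|_{L^p(\Omega)}\le C\|\boldsymbol w\|_{1,\Omega}$ for $\boldsymbol w\in H^1(\Omega)^d$, $C_{gn}$ the best constant in $\|\nabla\boldsymbol w\|_{L^{p_1}(\Omega)}\le C\|\boldsymbol w\|_{3/2+\delta,\Omega}$ for $\boldsymbol w\in H^{3/2+\delta}(\Omega)^d$, $\alpha_a$ the largest constant with $a(\boldsymbol y;\boldsymbol v,\boldsymbol v)\ge\alpha_a\|\boldsymbol v\|_{1,\Omega}^2$ for all $\boldsymbol y\in H^1(\Omega)^2$, $\boldsymbol v\in H_0^1(\Omega)^d$, and $\hat\alpha_a$ the largest constant with $a_{\boldsymbol y}(\boldsymbol s,\boldsymbol s)\ge\hat\alpha_a\|\boldsymbol s\|^2_{1,\Omega}$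 for all $\boldsymbol s\in[H_0^1(\Omega)]^2$. Let $M_{\boldsymbol u},M_{\boldsymbol y},M>0$ satisfy $$\alpha_a>C_{6_d}C_{3_d}\left(\frac{C_{\nu_T}C_{p_{2_d}}C_{gn}MM_{\boldsymbol y}}{\hat\alpha_a}+M_{\boldsymbol u}+\frac{C_{F_{\boldsymbol y}}M_{\boldsymbol y}}{\hat\alpha_a}\right).$$ Theorem. There are constants $C_{\boldsymbol\psi},C_{\boldsymbol\chi}>0$ such that for all $\bar{\boldsymbol u}\in\boldsymbol X\cap H^{3/2+\delta}(\Omega)^d$ and $\bar{\boldsymbol y}=(\bar T,\bar S)\in[H^{3/2+\delta}(\Omega)]^2$ with $$\|\bar{\boldsymbol u}\|_{1,\Omega}\le M_{\boldsymbol u},\qquad\|\bar{\boldsymbol y}\|_{1,\Omega}\le M_{\boldsymbol y},\qquad\|\bar{\boldsymbol u}\|_{3/2+\delta,\Omega}+\|\bar{\boldsymbol y}\|_{3/2+\delta,\Omega}\le M$$ (in particular for states associated with an admissible control, with $M_{\boldsymbol u},M_{\boldsymbol y},M$ their a priori bounds), and for all $\hat{\boldsymbol f}\in\boldsymbol X^*$,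 $\tilde{\boldsymbol f}\in[H^{-1}(\Omega)]^2$, there is exactly one $(\boldsymbol\psi,\boldsymbol\chi)\in\boldsymbol X\times[H^1_0(\Omega)]^2$, $\boldsymbol\chi=(\chi^T,\chi^S)$, with $$a(\bar{\boldsymbol y};\boldsymbol\psi,\boldsymbol v)+c(\boldsymbol\psi,\bar{\boldsymbol u},\boldsymbol v)+c(\bar{\boldsymbol u},\boldsymbol\psi,\boldsymbol v)+(\nu_T(\bar T)\chi^T\nabla\bar{\boldsymbol u},\nabla\boldsymbol v)-(\boldsymbol F_{\boldsymbol y}(\bar{\boldsymbol y})\boldsymbol\chi,\boldsymbol v)=\langle\hat{\boldsymbol f},\boldsymbol v\rangle\quad\forall\boldsymbol v\in\boldsymbol X,$$ $$a_{\boldsymbol y}(\boldsymbol\chi,\boldsymbol s)+c_{\boldsymbol y}(\bar{\boldsymbol u},\boldsymbol\chi,\boldsymbol s)+c_{\boldsymbol y}(\boldsymbol\psi,\bar{\boldsymbol y},\boldsymbol s)=\langle\tilde{\boldsymbol f},\boldsymbol s\rangle\quad\forall\boldsymbol s\in[H^1_0(\Omega)]^2,$$ and it satisfies $$\|\boldsymbol\psi\|_{1,\Omega}\le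 C_{\boldsymbol\psi}\big(\|\hat{\boldsymbol f}\|_{\boldsymbol X^*}+\|\tilde{\boldsymbol f}\|_{-1,\Omega}\big),\qquad\|\boldsymbol\chi\|_{1,\Omega}\le C_{\boldsymbol\chi}\big(\|\hat{\boldsymbol f}\|_{\boldsymbol X^*}+\|\tilde{\boldsymbol f}\|_{-1,\Omega}\big).$$ -/

import Mathlib

open MeasureTheory Set Topology
open scoped ENNReal NNReal ContDiff

noncomputable section

namespace DoublyDiffusive

/-- Euclidean space `ℝ^d`. -/
abbrev Pt (d : ℕ) := EuclideanSpace ℝ (Fin d)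

/-- Locally near each boundary point, and up to a rigid motion, `Ω` is the strict subgraph of a
Lipschitz function. Here `e` is the vertical direction and `x - ⟪x, e⟫ e` the horizontal part. -/
def HasLipschitzBoundary {d : ℕ} (Ω : Set (Pt d)) : Prop :=
  ∀ x₀ ∈ frontier Ω, ∃ (e : Pt d) (g : Pt d → ℝ) (L : ℝ≥0), ∃ U ∈ 𝓝 x₀,
    ‖e‖ = 1 ∧ LipschitzWith L g ∧
      ∀ x ∈ U, (x ∈ Ω ↔ inner ℝ x e < g (x - (inner ℝ x e) • e))

/-! ### Sobolev spaces -/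

/-- `L²(Ω)`. -/
abbrev L2 {d : ℕ} (Ω : Set (Pt d)) := Lp ℝ 2 (volume.restrict Ω)

/-- Classical partial derivative. -/
def pderiv {d : ℕ} (i : Fin d) (φ : Pt d → ℝ) (x : Pt d) : ℝ :=
  fderiv ℝ φ x (EuclideanSpace.single i 1)

/-- `φ ∈ C_c^∞(Ω)`. -/
def IsTest {d : ℕ} (Ω : Set (Pt d)) (φ : Pt d → ℝ) : Prop :=
  ContDiff ℝ ∞ φ ∧ HasCompactSupport φ ∧ tsupport φ ⊆ Ω

/-- A function (component `none`) together with candidates for its first partial derivatives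
(component `some i`), all in `L²(Ω)`, with the Hilbert norm
`(‖u‖² + ∑ i, ‖∂ᵢ u‖²)^(1/2)`. -/
abbrev Jet {d : ℕ} (Ω : Set (Pt d)) := PiLp 2 (fun _ : Option (Fin d) => L2 Ω)

theorem IsTest.memLp {d : ℕ} {Ω : Set (Pt d)} {φ : Pt d → ℝ} (h : IsTest Ω φ) :
    MemLp φ 2 (volume.restrict Ω) :=
  (h.1.continuous.memLp_of_hasCompactSupport h.2.1).restrict Ω

theorem IsTest.memLp_pderiv {d : ℕ} {Ω : Set (Pt d)} {φ : Pt d → ℝ} (h : IsTest Ω φ)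
    (i : Fin d) : MemLp (pderiv i φ) 2 (volume.restrict Ω) := by
  have hc : Continuous (pderiv i φ) :=
    (h.1.continuous_fderiv (by simp)).clm_apply continuous_const
  have hs : HasCompactSupport (pderiv i φ) := h.2.1.fderiv_apply ℝ _
  exact (hc.memLp_of_hasCompactSupport hs).restrict Ω

/-- `H¹(Ω)`: the functions in `L²(Ω)` with weak first derivatives in `L²(Ω)`. -/
def H1 {d : ℕ} (Ω : Set (Pt d)) : Submodule ℝ (Jet Ω) where
  carrier := {w | ∀ φ, IsTest Ω φ → ∀ i : Fin d,
    ∫ x in Ω, w none x * pderiv i φ x = - ∫ x in Ω, w (some i) x * φ x}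
  zero_mem' := by
    intro φ _ i
    have h0 : ∀ k : Option (Fin d), ((0 : Jet Ω) k : Pt d → ℝ) =ᵐ[volume.restrict Ω] 0 :=
      fun k => Lp.coeFn_zero ℝ 2 _
    rw [integral_congr_ae (g := fun _ => (0 : ℝ)) (by
        filter_upwards [h0 none] with x hx; rw [hx]; simp),
      integral_congr_ae (f := fun x => (0 : Jet Ω) (some i) x * φ x) (g := fun _ => (0 : ℝ)) (by
        filter_upwards [h0 (some i)] with x hx; rw [hx]; simp)]
    simp
  add_mem' := by
    intro u v hu hv φ hφ i
    have ha : ∀ k : Option (Fin d), ((u + v) k : Pt d → ℝ) =ᵐ[volume.restrict Ω]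
        fun x => u k x + v k x := fun k => Lp.coeFn_add (u k) (v k)
    have e1 : ∫ x in Ω, (u + v) none x * pderiv i φ x =
        (∫ x in Ω, u none x * pderiv i φ x) + ∫ x in Ω, v none x * pderiv i φ x := by
      refine Eq.trans ?_ (integral_add ((Lp.memLp (u none)).integrable_mul (hφ.memLp_pderiv i))
        ((Lp.memLp (v none)).integrable_mul (hφ.memLp_pderiv i)))
      refine integral_congr_ae ?_
      filter_upwards [ha none] with x hx
      rw [hx]; ring
    have e2 : ∫ x in Ω, (u + v) (some i) x * φ x =
        (∫ x in Ω, u (some i) x * φ x) + ∫ x in Ω, v (some i) x * φ x := by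
      refine Eq.trans ?_ (integral_add ((Lp.memLp (u (some i))).integrable_mul hφ.memLp)
        ((Lp.memLp (v (some i))).integrable_mul hφ.memLp))
      refine integral_congr_ae ?_
      filter_upwards [ha (some i)] with x hx
      rw [hx]; ring
    rw [e1, e2, hu φ hφ i, hv φ hφ i]; ring
  smul_mem' := by
    intro c u hu φ hφ i
    have ha : ∀ k : Option (Fin d), ((c • u) k : Pt d → ℝ) =ᵐ[volume.restrict Ω]
        fun x => c * u k x := fun k => Lp.coeFn_smul c (u k)
    have e1 : ∫ x in Ω, (c • u) none x * pderiv i φ x =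
        c * ∫ x in Ω, u none x * pderiv i φ x := by
      rw [← integral_const_mul]
      refine integral_congr_ae ?_
      filter_upwards [ha none] with x hx
      rw [hx]; ring
    have e2 : ∫ x in Ω, (c • u) (some i) x * φ x = c * ∫ x in Ω, u (some i) x * φ x := by
      rw [← integral_const_mul]
      refine integral_congr_ae ?_
      filter_upwards [ha (some i)] with x hx
      rw [hx]; ring
    rw [e1, e2, hu φ hφ i]; ring

/-- `H¹₀(Ω)`: the closure of `C_c^∞(Ω)` in `H¹(Ω)` (on a bounded Lipschitz domain, the functions
in `H¹(Ω)` with zero trace). -/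
def H10 {d : ℕ} (Ω : Set (Pt d)) : Submodule ℝ (H1 Ω) :=
  (Submodule.span ℝ {w : H1 Ω | ∃ φ, IsTest Ω φ ∧
    ((w : Jet Ω) none : Pt d → ℝ) =ᵐ[volume.restrict Ω] φ}).topologicalClosure

/-- `H¹(Ω)^m` with its Hilbert norm `‖·‖_{1,Ω}`. -/
abbrev H1v {d : ℕ} (Ω : Set (Pt d)) (m : ℕ) := PiLp 2 (fun _ : Fin m => H1 Ω)

/-- The value at `x` of a vector field in `H¹(Ω)^m`. -/
def val {d m : ℕ} {Ω : Set (Pt d)} (w : H1v Ω m) (x : Pt d) : EuclideanSpace ℝ (Fin m) :=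
  WithLp.toLp 2 (fun j => (w j : Jet Ω) none x)

/-- `∂ᵢ wⱼ (x)`. -/
def grad {d m : ℕ} {Ω : Set (Pt d)} (w : H1v Ω m) (j : Fin m) (i : Fin d) (x : Pt d) : ℝ :=
  (w j : Jet Ω) (some i) x

/-- `H¹₀(Ω)^m`. -/
def H10v {d : ℕ} (Ω : Set (Pt d)) (m : ℕ) : Submodule ℝ (H1v Ω m) where
  carrier := {w | ∀ j, w j ∈ H10 Ω}
  zero_mem' := fun _ => (H10 Ω).zero_mem
  add_mem' := fun hu hv j => (H10 Ω).add_mem (hu j) (hv j)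
  smul_mem' := fun c _ hu j => (H10 Ω).smul_mem c (hu j)

/-- The divergence `∑ i, ∂ᵢ vᵢ` in `L²(Ω)`. -/
def divergence {d : ℕ} {Ω : Set (Pt d)} (v : H1v Ω d) : L2 Ω := ∑ i, (v i : Jet Ω) (some i)

/-- `X`: the divergence-free fields in `H¹₀(Ω)^d`. -/
def X {d : ℕ} (Ω : Set (Pt d)) : Submodule ℝ (H1v Ω d) where
  carrier := {v | v ∈ H10v Ω d ∧ divergence v = 0}
  zero_mem' := ⟨(H10v Ω d).zero_mem, by simp [divergence]⟩
  add_mem' := by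
    rintro u v ⟨hu, hu'⟩ ⟨hv, hv'⟩
    refine ⟨(H10v Ω d).add_mem hu hv, ?_⟩
    have : divergence (u + v) = divergence u + divergence v := by
      simp [divergence, Finset.sum_add_distrib]
    rw [this, hu', hv', add_zero]
  smul_mem' := by
    rintro c u ⟨hu, hu'⟩
    refine ⟨(H10v Ω d).smul_mem c hu, ?_⟩
    have : divergence (c • u) = c • divergence u := by
      simp [divergence, Finset.smul_sum]
    rw [this, hu', smul_zero]

/-- Square of the Gagliardo–Slobodeckij seminorm of order `σ ∈ (0,1)` on `Ω ⊆ ℝ^d`. -/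
def gagliardoSq {d : ℕ} (Ω : Set (Pt d)) (σ : ℝ) (f : Pt d → ℝ) : ℝ≥0∞ :=
  ∫⁻ x in Ω, ∫⁻ y in Ω, ‖f x - f y‖ₑ ^ 2 / ‖x - y‖ₑ ^ ((d : ℝ) + 2 * σ)

/-- The norm `‖w‖_{1+σ,Ω}` of a field in `H¹(Ω)^m`, for `σ ∈ (0,1)`; the value is `∞` when `w` is
not in `H^{1+σ}(Ω)^m`. -/
def fracNorm {d m : ℕ} {Ω : Set (Pt d)} (σ : ℝ) (w : H1v Ω m) : ℝ≥0∞ :=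
  (‖w‖ₑ ^ 2 + ∑ j, ∑ i, gagliardoSq Ω σ (grad w j i)) ^ (1 / 2 : ℝ)

/-- `w ∈ H^{1+σ}(Ω)^m`. -/
def MemFrac {d m : ℕ} {Ω : Set (Pt d)} (σ : ℝ) (w : H1v Ω m) : Prop := fracNorm σ w < ⊤

/-- The norm of `w` in `L^p(Ω)^m`. -/
def lpNorm {d m : ℕ} {Ω : Set (Pt d)} (p : ℝ≥0∞) (w : H1v Ω m) : ℝ≥0∞ :=
  eLpNorm (val w) p (volume.restrict Ω)

/-- The `L^p(Ω)` norm of `∇w` (pointwise Frobenius norm). -/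
def gradLpNorm {d m : ℕ} {Ω : Set (Pt d)} (p : ℝ≥0∞) (w : H1v Ω m) : ℝ≥0∞ :=
  eLpNorm (fun x => √(∑ j, ∑ i, grad w j i x ^ 2)) p (volume.restrict Ω)

/-! ### The forms of the problem -/

/-- `a(y; u, v) = (K⁻¹ u, v) + (ν(T) ∇u, ∇v)`, where `T` is the first component of `y`. -/
def formA {d : ℕ} {Ω : Set (Pt d)} (K : Pt d → Matrix (Fin d) (Fin d) ℝ) (ν : ℝ → ℝ)
    (y : H1v Ω 2) (u v : H1v Ω d) : ℝ :=
  (∫ x in Ω, ∑ i, ∑ j, (K x)⁻¹ i j * val u x j * val v x i) +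
    ∫ x in Ω, ν (val y x 0) * ∑ j, ∑ i, grad u j i x * grad v j i x

/-- `((w · ∇) u, v)`; this is `c` for `m = d` and `c_y` for `m = 2`. -/
def formC {d m : ℕ} {Ω : Set (Pt d)} (w : H1v Ω d) (u v : H1v Ω m) : ℝ :=
  ∫ x in Ω, ∑ j, (∑ i, val w x i * grad u j i x) * val v x j

/-- `a_y(y, s) = (D ∇y, ∇s)`. -/
def formAy {d : ℕ} {Ω : Set (Pt d)} (D : Matrix (Fin 2) (Fin 2) ℝ) (y s : H1v Ω 2) : ℝ :=
  ∫ x in Ω, ∑ i, ∑ k, ∑ l, D k l * grad y l i x * grad s k i x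

/-- `(ν_T(T̄) χ^T ∇ū, ∇v)`. -/
def formNuT {d : ℕ} {Ω : Set (Pt d)} (ν : ℝ → ℝ) (ybar χ : H1v Ω 2) (ubar v : H1v Ω d) : ℝ :=
  ∫ x in Ω, deriv ν (val ybar x 0) * val χ x 0 * ∑ j, ∑ i, grad ubar j i x * grad v j i x

/-- `(F_y(ȳ) χ, v)`. -/
def formFy {d : ℕ} {Ω : Set (Pt d)} (F : Pt 2 → Pt d) (ybar χ : H1v Ω 2) (v : H1v Ω d) : ℝ :=
  ∫ x in Ω, inner ℝ (fderiv ℝ F (val ybar x) (val χ x)) (val v x)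

/-- `(ψ, χ)` solves the equations linearized at `(ū, ȳ)` with right-hand sides `f̂`, `f̃`. -/
def IsLinearizedSolution {d : ℕ} {Ω : Set (Pt d)} (K : Pt d → Matrix (Fin d) (Fin d) ℝ)
    (ν : ℝ → ℝ) (F : Pt 2 → Pt d) (D : Matrix (Fin 2) (Fin 2) ℝ) (ubar : H1v Ω d)
    (ybar : H1v Ω 2) (fhat : StrongDual ℝ (X Ω)) (ftil : StrongDual ℝ (H10v Ω 2))
    (ψ : X Ω) (χ : H10v Ω 2) : Prop :=
  (∀ v : X Ω,
    formA K ν ybar ψ v + formC (ψ : H1v Ω d) ubar (v : H1v Ω d)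
      + formC ubar (ψ : H1v Ω d) (v : H1v Ω d)
      + formNuT ν ybar χ ubar v - formFy F ybar χ v = fhat v) ∧
  (∀ s : H10v Ω 2,
    formAy D (χ : H1v Ω 2) s + formC ubar (χ : H1v Ω 2) (s : H1v Ω 2)
      + formC (ψ : H1v Ω d) ybar (s : H1v Ω 2) = ftil s)

/-! ### The constants in the smallness condition -/

/-- The best constant `C` in `‖w‖_{L^p(Ω)} ≤ C ‖w‖_{1,Ω}`, `w ∈ H¹(Ω)^d`. -/
def embConst {d : ℕ} (Ω : Set (Pt d)) (p : ℝ≥0∞) : ℝ≥0∞ :=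
  sInf {C | ∀ w : H1v Ω d, lpNorm p w ≤ C * ‖w‖ₑ}

/-- The best constant `C` in `‖∇w‖_{L^p(Ω)} ≤ C ‖w‖_{1+σ,Ω}`, `w ∈ H^{1+σ}(Ω)^d`. -/
def gradEmbConst {d : ℕ} (Ω : Set (Pt d)) (σ : ℝ) (p : ℝ≥0∞) : ℝ≥0∞ :=
  sInf {C | ∀ w : H1v Ω d, MemFrac σ w → gradLpNorm p w ≤ C * fracNorm σ w}

/-- The best constant `α_a` in `a(y; v, v) ≥ α_a ‖v‖²_{1,Ω}`, for `y ∈ H¹(Ω)²` and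
`v ∈ H¹₀(Ω)^d`. -/
def coercA {d : ℕ} (Ω : Set (Pt d)) (K : Pt d → Matrix (Fin d) (Fin d) ℝ) (ν : ℝ → ℝ) : ℝ≥0∞ :=
  sSup {α | ∀ (y : H1v Ω 2) (v : H10v Ω d), α * ‖v‖ₑ ^ 2 ≤ ENNReal.ofReal (formA K ν y v v)}

/-- The best constant `α̂_a` in `a_y(s, s) ≥ α̂_a ‖s‖²_{1,Ω}`, for `s ∈ H¹₀(Ω)²`. -/
def coercAy {d : ℕ} (Ω : Set (Pt d)) (D : Matrix (Fin 2) (Fin 2) ℝ) : ℝ≥0∞ :=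
  sSup {α | ∀ s : H10v Ω 2,
    α * ‖s‖ₑ ^ 2 ≤ ENNReal.ofReal (formAy D (s : H1v Ω 2) (s : H1v Ω 2))}

/-- The exponent `p₁` with `H^{3/2+δ}(Ω) ⊆ W^{1,p₁}(Ω)`: it is `4/(1-2δ)` for `d = 2` and
`3/(1-δ)` for `d = 3`. -/
def p₁ (d : ℕ) (δ : ℝ) : ℝ := 2 * d / (d - 1 - 2 * δ)

/-- The exponent `p₂` with `1/p₁ + 1/p₂ = 1/2`. -/
def p₂ (d : ℕ) (δ : ℝ) : ℝ := 2 * d / (1 + 2 * δ)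

/-- The smallness condition
`α_a > C₆ C₃ (C_{ν_T} C_{p₂} C_gn M M_y / α̂_a + M_u + C_{F_y} M_y / α̂_a)`. -/
def Smallness {d : ℕ} (Ω : Set (Pt d)) (K : Pt d → Matrix (Fin d) (Fin d) ℝ) (ν : ℝ → ℝ)
    (D : Matrix (Fin 2) (Fin 2) ℝ) (δ : ℝ) (CνT CFy Mu My M : ℝ≥0) : Prop :=
  embConst Ω 6 * embConst Ω 3 *
    (CνT * embConst Ω (ENNReal.ofReal (p₂ d δ))
        * gradEmbConst Ω (1 / 2 + δ) (ENNReal.ofReal (p₁ d δ)) * M * My / coercAy Ω D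
      + Mu + CFy * My / coercAy Ω D) < coercA Ω K ν

end DoublyDiffusive

end

open DoublyDiffusive

/-!
The transport equation is coercive in `χ`, so it can be solved for `χ` in terms of `ψ`. Substituting
the result into the momentum equation leaves an equation for `ψ ∈ X` alone, whose form is coercive
with constant `α_a - C₆ C₃ M_u - (C_{ν_T} C_{p₂} C_gn M + C_{F_y}) C₆ C₃ M_y / α̂_a`, and the
smallness condition says precisely that this number is positive. The terms `c(ū, ψ, v)` and
`c_y(ū, χ, s)` do not enter the constant because they are skew-symmetric for divergence-free `ū`.
All other terms are estimated by Hölder's inequality, with exponents `(6, 2, 3)` for convection and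
`(p₁, p₂, 2)` for the viscosity term.
-/

namespace DoublyDiffusive

/-! ### Bounded bilinear forms and coupled coercive systems -/

section BoundedForms

variable {U V : Type*} [NormedAddCommGroup U] [NormedSpace ℝ U] [NormedAddCommGroup V]
  [NormedSpace ℝ V] {B B' : U → V → ℝ} {C C' : ℝ}

/-- `B` is bilinear and `|B u v| ≤ C ‖u‖ ‖v‖`. This is a predicate on plain functions because the
forms of the problem are given as integrals. -/
structure IsBoundedForm (B : U → V → ℝ) (C : ℝ) : Prop where
  add_left : ∀ u u' v, B (u + u') v = B u v + B u' v
  smul_left : ∀ (c : ℝ) u v, B (c • u) v = c * B u v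
  add_right : ∀ u v v', B u (v + v') = B u v + B u v'
  smul_right : ∀ (c : ℝ) u v, B u (c • v) = c * B u v
  abs_le : ∀ u v, |B u v| ≤ C * ‖u‖ * ‖v‖

namespace IsBoundedForm

theorem mono (h : IsBoundedForm B C) (hC : C ≤ C') : IsBoundedForm B C' where
  __ := h
  abs_le u v := (h.abs_le u v).trans (by gcongr)

theorem add (h : IsBoundedForm B C) (h' : IsBoundedForm B' C') :
    IsBoundedForm (fun u v => B u v + B' u v) (C + C') where
  add_left u u' v := by rw [h.add_left, h'.add_left]; ring
  smul_left c u v := by rw [h.smul_left, h'.smul_left]; ring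
  add_right u v v' := by rw [h.add_right, h'.add_right]; ring
  smul_right c u v := by rw [h.smul_right, h'.smul_right]; ring
  abs_le u v := (abs_add_le _ _).trans ((add_le_add (h.abs_le u v) (h'.abs_le u v)).trans_eq
    (by ring))

theorem const_mul (h : IsBoundedForm B C) (c : ℝ) :
    IsBoundedForm (fun u v => c * B u v) (|c| * C) where
  add_left u u' v := by rw [h.add_left, mul_add]
  smul_left c' u v := by rw [h.smul_left, mul_left_comm]
  add_right u v v' := by rw [h.add_right, mul_add]
  smul_right c' u v := by rw [h.smul_right, mul_left_comm]
  abs_le u v := by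
    rw [abs_mul, mul_assoc |c|, mul_assoc |c|]
    exact mul_le_mul_of_nonneg_left (h.abs_le u v) (abs_nonneg c)

theorem sum {ι : Type*} (s : Finset ι) {B : ι → U → V → ℝ} {C : ι → ℝ}
    (h : ∀ i, IsBoundedForm (B i) (C i)) :
    IsBoundedForm (fun u v => ∑ i ∈ s, B i u v) (∑ i ∈ s, C i) where
  add_left u u' v := by simp only [(h _).add_left, Finset.sum_add_distrib]
  smul_left c u v := by simp only [(h _).smul_left, Finset.mul_sum]
  add_right u v v' := by simp only [(h _).add_right, Finset.sum_add_distrib]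
  smul_right c u v := by simp only [(h _).smul_right, Finset.mul_sum]
  abs_le u v := by
    rw [Finset.sum_mul, Finset.sum_mul]
    exact (Finset.abs_sum_le_sum_abs _ _).trans (Finset.sum_le_sum fun i _ => (h i).abs_le u v)

theorem sub (h : IsBoundedForm B C) (h' : IsBoundedForm B' C') :
    IsBoundedForm (fun u v => B u v - B' u v) (C + C') := by
  simpa only [neg_one_mul, abs_neg, abs_one, one_mul, sub_eq_add_neg] using
    h.add (h'.const_mul (-1))

theorem restrict (h : IsBoundedForm B C) (P : Submodule ℝ U) (Q : Submodule ℝ V) :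
    IsBoundedForm (fun (u : P) (v : Q) => B u v) C :=
  ⟨fun _ _ _ => h.add_left _ _ _, fun _ _ _ => h.smul_left _ _ _,
    fun _ _ _ => h.add_right _ _ _, fun _ _ _ => h.smul_right _ _ _, fun _ _ => h.abs_le _ _⟩

/-- The continuous bilinear map with values `B u v`. -/
noncomputable def toCLM (h : IsBoundedForm B C) : U →L[ℝ] V →L[ℝ] ℝ :=
  (LinearMap.mk₂ ℝ B h.add_left h.smul_left h.add_right h.smul_right).mkContinuous₂ C h.abs_le

@[simp]
theorem toCLM_apply (h : IsBoundedForm B C) (u : U) (v : V) : h.toCLM u v = B u v :=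
  rfl

end IsBoundedForm

end BoundedForms

section CoupledSystem

theorem mul_norm_le_of_mul_norm_sq_le {V : Type*} [NormedAddCommGroup V] {A c : ℝ} {v : V}
    (hc : 0 ≤ c) (h : A * ‖v‖ ^ 2 ≤ c * ‖v‖) : A * ‖v‖ ≤ c := by
  rcases (norm_nonneg v).eq_or_lt with h0 | h0
  · rwa [← h0, mul_zero]
  · exact le_of_mul_le_mul_right (by linarith) h0

theorem exists_solutionOperator_of_isCoercive {V : Type*} [NormedAddCommGroup V]
    [InnerProductSpace ℝ V] [CompleteSpace V] {a : V →L[ℝ] V →L[ℝ] ℝ} (ha : IsCoercive a) :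
    ∃ S : StrongDual ℝ V →L[ℝ] V, ∀ f, a (S f) = f := by
  refine ⟨ha.continuousLinearEquivOfBilin.symm.toContinuousLinearMap ∘L
    (InnerProductSpace.toDual ℝ V).symm.toContinuousLinearEquiv.toContinuousLinearMap,
    fun f => ?_⟩
  ext v
  rw [← ha.continuousLinearEquivOfBilin_apply]
  simp

variable {U Y : Type*} [NormedAddCommGroup U] [InnerProductSpace ℝ U]
  [NormedAddCommGroup Y] [InnerProductSpace ℝ Y]
  {a : U →L[ℝ] U →L[ℝ] ℝ} {b : Y →L[ℝ] U →L[ℝ] ℝ} {e : Y →L[ℝ] Y →L[ℝ] ℝ}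
  {g : U →L[ℝ] Y →L[ℝ] ℝ} {A B α E : ℝ}

theorem mul_norm_le_of_coercive_of_eq {u : U} {y : Y} {f : StrongDual ℝ U}
    (ha : A * ‖u‖ ^ 2 ≤ a u u) (hB : 0 ≤ B) (hb : |b y u| ≤ B * ‖y‖ * ‖u‖)
    (h : a u u + b y u = f u) : A * ‖u‖ ≤ ‖f‖ + B * ‖y‖ := by
  refine mul_norm_le_of_mul_norm_sq_le (by positivity) ?_
  have hf : f u ≤ ‖f‖ * ‖u‖ := (le_abs_self _).trans (f.le_opNorm u)
  linarith [neg_le_of_abs_le hb]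

theorem norm_le_of_coupledSystem (hα : 0 < α) (hB : 0 ≤ B) (hE : 0 ≤ E) (h : B * E < A * α)
    (ha : ∀ u, A * ‖u‖ ^ 2 ≤ a u u) (hb : ∀ y u, |b y u| ≤ B * ‖y‖ * ‖u‖)
    (he : ∀ y, α * ‖y‖ ^ 2 ≤ e y y) (hg : ∀ u y, |g u y| ≤ E * ‖u‖ * ‖y‖)
    {f₁ : StrongDual ℝ U} {f₂ : StrongDual ℝ Y} {u : U} {y : Y}
    (hu : a u + b y = f₁) (hy : e y + g u = f₂) :
    ‖u‖ ≤ (α * ‖f₁‖ + B * ‖f₂‖) / (A * α - B * E) ∧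
      ‖y‖ ≤ (E * ‖f₁‖ + A * ‖f₂‖) / (A * α - B * E) := by
  have hA : 0 < A := pos_of_mul_pos_left ((mul_nonneg hB hE).trans_lt h) hα.le
  have h₁ := mul_norm_le_of_coercive_of_eq (ha u) hB (hb y u) (DFunLike.congr_fun hu u)
  have h₂ := mul_norm_le_of_coercive_of_eq (he y) hE (hg u y) (DFunLike.congr_fun hy y)
  rw [le_div_iff₀' (sub_pos.2 h), le_div_iff₀' (sub_pos.2 h)]
  constructor
  · linarith [mul_le_mul_of_nonneg_left h₁ hα.le, mul_le_mul_of_nonneg_left h₂ hB]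
  · linarith [mul_le_mul_of_nonneg_left h₁ hE, mul_le_mul_of_nonneg_left h₂ hA.le]

theorem isCoercive_schurComplement (hα : 0 < α) (hB : 0 ≤ B) (hE : 0 ≤ E) (h : B * E < A * α)
    (ha : ∀ u, A * ‖u‖ ^ 2 ≤ a u u) (hb : ∀ y u, |b y u| ≤ B * ‖y‖ * ‖u‖)
    (he : ∀ y, α * ‖y‖ ^ 2 ≤ e y y) (hg : ∀ u y, |g u y| ≤ E * ‖u‖ * ‖y‖)
    {S : StrongDual ℝ Y →L[ℝ] Y} (hS : ∀ f, e (S f) = f) : IsCoercive (a - b ∘L S ∘L g) := by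
  refine ⟨A - B * E / α, sub_pos.2 ((div_lt_iff₀ hα).2 h), fun u => ?_⟩
  have hSg : ‖S (g u)‖ ≤ E * ‖u‖ / α := by
    rw [le_div_iff₀' hα]
    refine mul_norm_le_of_mul_norm_sq_le (by positivity) ((he _).trans ?_)
    rw [hS]
    exact (le_abs_self _).trans (hg u _)
  have hbS : b (S (g u)) u ≤ B * (E * ‖u‖ / α) * ‖u‖ :=
    ((le_abs_self _).trans (hb _ u)).trans (by gcongr)
  calc (A - B * E / α) * ‖u‖ * ‖u‖ = A * ‖u‖ ^ 2 - B * (E * ‖u‖ / α) * ‖u‖ := by ring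
    _ ≤ a u u - b (S (g u)) u := sub_le_sub (ha u) hbS

theorem existsUnique_coupledSystem [CompleteSpace U] [CompleteSpace Y] (hα : 0 < α)
    (hB : 0 ≤ B) (hE : 0 ≤ E) (h : B * E < A * α)
    (ha : ∀ u, A * ‖u‖ ^ 2 ≤ a u u) (hb : ∀ y u, |b y u| ≤ B * ‖y‖ * ‖u‖)
    (he : ∀ y, α * ‖y‖ ^ 2 ≤ e y y) (hg : ∀ u y, |g u y| ≤ E * ‖u‖ * ‖y‖)
    (f₁ : StrongDual ℝ U) (f₂ : StrongDual ℝ Y) :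
    ∃! p : U × Y, a p.1 + b p.2 = f₁ ∧ e p.2 + g p.1 = f₂ := by
  obtain ⟨S, hS⟩ := exists_solutionOperator_of_isCoercive (a := e)
    ⟨α, hα, fun y => by simpa only [mul_assoc, sq] using he y⟩
  obtain ⟨R, hR⟩ := exists_solutionOperator_of_isCoercive
    (isCoercive_schurComplement hα hB hE h ha hb he hg hS)
  let u := R (f₁ - b (S f₂))
  have hu : a u - b (S (g u)) = f₁ - b (S f₂) := hR _
  let y := S f₂ - S (g u)
  have hu_eq : a u + b y = f₁ := by
    rw [map_sub, add_sub, add_sub_right_comm, hu, sub_add_cancel]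
  have hy_eq : e y + g u = f₂ := by rw [map_sub, hS, hS, sub_add_cancel]
  refine ⟨(u, y), ⟨hu_eq, hy_eq⟩, ?_⟩
  rintro ⟨u', y'⟩ ⟨hu', hy'⟩
  have hdiff := norm_le_of_coupledSystem hα hB hE h ha hb he hg
    (f₁ := 0) (f₂ := 0) (u := u' - u) (y := y' - y)
    (by rw [map_sub, map_sub b, sub_add_sub_comm, hu', hu_eq, sub_self])
    (by rw [map_sub, map_sub g, sub_add_sub_comm, hy', hy_eq, sub_self])
  simp only [norm_zero, mul_zero, add_zero, zero_div, norm_le_zero_iff, sub_eq_zero] at hdiff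
  exact Prod.ext hdiff.1 hdiff.2

theorem coupledSystem_wellPosed [CompleteSpace U] [CompleteSpace Y] {a : U → U → ℝ}
    {b : Y → U → ℝ} {e : Y → Y → ℝ} {g : U → Y → ℝ} {Ca Ce : ℝ} (hα : 0 < α) (hB : 0 ≤ B)
    (hE : 0 ≤ E) (h : B * E < A * α) (ha : IsBoundedForm a Ca) (ha' : ∀ u, A * ‖u‖ ^ 2 ≤ a u u)
    (hb : IsBoundedForm b B) (he : IsBoundedForm e Ce) (he' : ∀ y, α * ‖y‖ ^ 2 ≤ e y y)
    (hg : IsBoundedForm g E) (f₁ : StrongDual ℝ U) (f₂ : StrongDual ℝ Y) :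
    (∃! p : U × Y, (∀ v, a p.1 v + b p.2 v = f₁ v) ∧ ∀ s, e p.2 s + g p.1 s = f₂ s) ∧
      ∀ u y, ((∀ v, a u v + b y v = f₁ v) ∧ ∀ s, e y s + g u s = f₂ s) →
        ‖u‖ ≤ max α B / (A * α - B * E) * (‖f₁‖ + ‖f₂‖) ∧
          ‖y‖ ≤ max E A / (A * α - B * E) * (‖f₁‖ + ‖f₂‖) := by
  have hiff : ∀ u y, ((∀ v, a u v + b y v = f₁ v) ∧ ∀ s, e y s + g u s = f₂ s) ↔
      ha.toCLM u + hb.toCLM y = f₁ ∧ he.toCLM y + hg.toCLM u = f₂ := fun u y => by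
    simp only [ContinuousLinearMap.ext_iff, add_apply, IsBoundedForm.toCLM_apply]
  simp only [hiff]
  refine ⟨existsUnique_coupledSystem hα hB hE h ha' hb.abs_le he' hg.abs_le f₁ f₂,
    fun u y huy => ?_⟩
  have : 0 ≤ A * α - B * E := (sub_pos.2 h).le
  obtain ⟨hu, hy⟩ := norm_le_of_coupledSystem hα hB hE h ha' hb.abs_le he' hg.abs_le huy.1 huy.2
  simp only [div_mul_eq_mul_div, mul_add (max _ _)]
  refine ⟨hu.trans ?_, hy.trans ?_⟩ <;> gcongr
  exacts [le_max_left _ _, le_max_right _ _, le_max_left _ _, le_max_right _ _]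

end CoupledSystem

/-! ### Bounded forms given by integrals -/

section IntegralForms

variable {α E F U V : Type*} [MeasurableSpace α] {μ : Measure α}
  [NormedAddCommGroup E] [NormedSpace ℝ E] [NormedAddCommGroup F] [NormedSpace ℝ F]

theorem eLpNorm_one_le_of_abs_le_mul_mul {β ρ : α → ℝ} {f : α → E} {g : α → F}
    (p q r t : ℝ≥0∞) [ENNReal.HolderTriple r p t] [ENNReal.HolderTriple t q 1]
    (hρ : AEStronglyMeasurable ρ μ) (hf : AEStronglyMeasurable f μ)
    (hg : AEStronglyMeasurable g μ) (h : ∀ᵐ x ∂μ, |β x| ≤ ρ x * ‖f x‖ * ‖g x‖) :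
    eLpNorm β 1 μ ≤ eLpNorm ρ r μ * eLpNorm f p μ * eLpNorm g q μ := by
  have hρf : AEStronglyMeasurable (fun x => ‖ρ x • f x‖) μ := (hρ.smul hf).norm
  calc eLpNorm β 1 μ ≤ eLpNorm ((fun x => ‖ρ x • f x‖) • g) 1 μ := by
        refine eLpNorm_mono_ae (h.mono fun x hx => hx.trans ?_)
        simp only [Pi.smul_apply', norm_smul, norm_mul, norm_norm]
        gcongr
        exact Real.le_norm_self _
    _ ≤ eLpNorm (fun x => ‖ρ x • f x‖) t μ * eLpNorm g q μ := eLpNorm_smul_le_mul_eLpNorm hg hρf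
    _ ≤ eLpNorm ρ r μ * eLpNorm f p μ * eLpNorm g q μ := by
        rw [eLpNorm_norm]
        gcongr
        exact eLpNorm_smul_le_mul_eLpNorm hf hρ

variable [NormedAddCommGroup U] [NormedSpace ℝ U] [NormedAddCommGroup V] [NormedSpace ℝ V]

/-- The functions `J u` are measurable and depend linearly on `u`, up to null sets. It applies to
the pointwise values and gradients of Sobolev functions, which are chosen representatives. -/
structure IsAELinear (μ : Measure α) (J : U → α → E) : Prop where
  aestronglyMeasurable : ∀ u, AEStronglyMeasurable (J u) μ
  map_add : ∀ u u', ∀ᵐ x ∂μ, J (u + u') x = J u x + J u' x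
  map_smul : ∀ (c : ℝ) u, ∀ᵐ x ∂μ, J (c • u) x = c • J u x

theorem isBoundedForm_integral {J : U → α → E} {J' : V → α → F} {β : α → E → F → ℝ} {ρ : α → ℝ}
    {N K K' : ℝ≥0∞} (p q r t : ℝ≥0∞) [ENNReal.HolderTriple r p t] [ENNReal.HolderTriple t q 1]
    (hJ : IsAELinear μ J) (hJ' : IsAELinear μ J') (hβ : ∀ᵐ x ∂μ, IsBoundedForm (β x) (ρ x))
    (hβm : ∀ u v, AEStronglyMeasurable (fun x => β x (J u x) (J' v x)) μ)
    (hρ : AEStronglyMeasurable ρ μ) (hN : eLpNorm ρ r μ ≤ N)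
    (hK : ∀ u, eLpNorm (J u) p μ ≤ K * ‖u‖ₑ) (hK' : ∀ v, eLpNorm (J' v) q μ ≤ K' * ‖v‖ₑ)
    (hfin : N * K * K' ≠ ⊤) :
    IsBoundedForm (fun u v => ∫ x, β x (J u x) (J' v x) ∂μ) (N * K * K').toReal := by
  have hL1 : ∀ u v, eLpNorm (fun x => β x (J u x) (J' v x)) 1 μ ≤ N * K * K' * ‖u‖ₑ * ‖v‖ₑ := by
    intro u v
    calc _ ≤ eLpNorm ρ r μ * eLpNorm (J u) p μ * eLpNorm (J' v) q μ :=
          eLpNorm_one_le_of_abs_le_mul_mul p q r t hρ (hJ.aestronglyMeasurable u)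
            (hJ'.aestronglyMeasurable v) (hβ.mono fun x hx => hx.abs_le _ _)
      _ ≤ N * (K * ‖u‖ₑ) * (K' * ‖v‖ₑ) := by gcongr; exacts [hK u, hK' v]
      _ = N * K * K' * ‖u‖ₑ * ‖v‖ₑ := by ring
  have hint : ∀ u v, Integrable (fun x => β x (J u x) (J' v x)) μ := fun u v =>
    memLp_one_iff_integrable.1 ⟨hβm u v, (hL1 u v).trans_lt (by finiteness)⟩
  refine ⟨fun u u' v => ?_, fun c u v => ?_, fun u v v' => ?_, fun c u v => ?_, fun u v => ?_⟩
  · rw [← integral_add (hint u v) (hint u' v)]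
    refine integral_congr_ae ?_
    filter_upwards [hβ, hJ.map_add u u'] with x hx hadd
    rw [hadd, hx.add_left]
  · rw [← integral_const_mul]
    refine integral_congr_ae ?_
    filter_upwards [hβ, hJ.map_smul c u] with x hx hsmul
    rw [hsmul, hx.smul_left]
  · rw [← integral_add (hint u v) (hint u v')]
    refine integral_congr_ae ?_
    filter_upwards [hβ, hJ'.map_add v v'] with x hx hadd
    rw [hadd, hx.add_right]
  · rw [← integral_const_mul]
    refine integral_congr_ae ?_
    filter_upwards [hβ, hJ'.map_smul c v] with x hx hsmul
    rw [hsmul, hx.smul_right]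
  · have h := (enorm_integral_le_lintegral_enorm _).trans
      (eLpNorm_one_eq_lintegral_enorm.symm.trans_le (hL1 u v))
    simpa using ENNReal.toReal_mono (by finiteness) h

theorem isBoundedForm_integral_of_eLpNorm_two_le {J : U → α → E} {J' : V → α → F}
    {β : α → E → F → ℝ} {C : ℝ} (hC : 0 ≤ C) (hJ : IsAELinear μ J) (hJ' : IsAELinear μ J')
    (hβ : ∀ᵐ x ∂μ, IsBoundedForm (β x) C)
    (hβm : ∀ u v, AEStronglyMeasurable (fun x => β x (J u x) (J' v x)) μ)
    (h : ∀ u, eLpNorm (J u) 2 μ ≤ ‖u‖ₑ) (h' : ∀ v, eLpNorm (J' v) 2 μ ≤ ‖v‖ₑ) :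
    IsBoundedForm (fun u v => ∫ x, β x (J u x) (J' v x) ∂μ) C := by
  have hN : eLpNorm (fun _ => C) ⊤ μ ≤ ENNReal.ofReal C := by
    rw [eLpNorm_exponent_top]
    exact eLpNormEssSup_le_of_ae_enorm_bound (ae_of_all _ fun _ => (Real.enorm_of_nonneg hC).le)
  simpa [hC] using isBoundedForm_integral 2 2 ⊤ 2 hJ hJ' hβ hβm aestronglyMeasurable_const hN
    (K := 1) (K' := 1) (by simpa using h) (by simpa using h') (by simp)

end IntegralForms

section PointwiseForms

variable {ι κ : Type*} [Fintype ι] [Fintype κ]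

theorem isBoundedForm_inner_map {E F : Type*} [NormedAddCommGroup E] [NormedSpace ℝ E]
    [NormedAddCommGroup F] [InnerProductSpace ℝ F] (L : E →ₗ[ℝ] F) {C : ℝ}
    (hL : ∀ u, ‖L u‖ ≤ C * ‖u‖) : IsBoundedForm (fun u v => inner ℝ (L u) v) C where
  add_left u u' v := by rw [map_add, inner_add_left]
  smul_left c u v := by rw [map_smul, real_inner_smul_left]
  add_right u := inner_add_right (L u)
  smul_right c u v := real_inner_smul_right (L u) v c
  abs_le u v := (abs_real_inner_le_norm _ _).trans (by gcongr; exact hL u)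

theorem isBoundedForm_coord_mul_coord (i : ι) (k : κ) :
    IsBoundedForm (fun (u : EuclideanSpace ℝ ι) (v : EuclideanSpace ℝ κ) => u i * v k) 1 where
  add_left u u' v := add_mul _ _ _
  smul_left c u v := mul_assoc _ _ _
  add_right u v v' := mul_add _ _ _
  smul_right c u v := mul_left_comm _ _ _
  abs_le u v := by
    rw [abs_mul, one_mul]
    exact mul_le_mul (PiLp.norm_apply_le u i) (PiLp.norm_apply_le v k) (abs_nonneg _)
      (norm_nonneg _)

theorem isBoundedForm_inv_of_mul_dotProduct_le [DecidableEq ι] {A : Matrix ι ι ℝ} {κ : ℝ}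
    (hκ : 0 < κ) (hA : ∀ v, κ * (v ⬝ᵥ v) ≤ v ⬝ᵥ A.mulVec v) :
    IsBoundedForm (fun u v : EuclideanSpace ℝ ι => ∑ i, ∑ j, A⁻¹ i j * u j * v i) κ⁻¹ := by
  have hdet : IsUnit A.det := by
    refine isUnit_iff_ne_zero.2 fun h0 => ?_
    obtain ⟨v, hv, hv0⟩ := Matrix.exists_mulVec_eq_zero_iff.2 h0
    have hle := hA v
    rw [hv0, dotProduct_zero] at hle
    exact hv (dotProduct_self_eq_zero.1 ((nonpos_of_mul_nonpos_right hle hκ).antisymm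
      (Finset.sum_nonneg fun i _ => mul_self_nonneg (v i))))
  have hbound : ∀ u, ‖Matrix.toEuclideanLin A⁻¹ u‖ ≤ κ⁻¹ * ‖u‖ := by
    intro u
    set w := Matrix.toEuclideanLin A⁻¹ u with hw
    have hAw : A.mulVec w.ofLp = u.ofLp := by
      rw [hw, Matrix.toLpLin_apply, Matrix.mulVec_mulVec, Matrix.mul_nonsing_inv _ hdet,
        Matrix.one_mulVec]
    rw [le_inv_mul_iff₀ hκ]
    refine mul_norm_le_of_mul_norm_sq_le (norm_nonneg u) ?_
    calc κ * ‖w‖ ^ 2 = κ * (w.ofLp ⬝ᵥ w.ofLp) := by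
          rw [EuclideanSpace.real_norm_sq_eq]; simp only [dotProduct, sq]
      _ ≤ w.ofLp ⬝ᵥ u.ofLp := by rw [← hAw]; exact hA _
      _ ≤ ‖u‖ * ‖w‖ := (le_abs_self _).trans (abs_real_inner_le_norm u w)
  have hinner : ∀ u v : EuclideanSpace ℝ ι,
      ∑ i, ∑ j, A⁻¹ i j * u j * v i = inner ℝ (Matrix.toEuclideanLin A⁻¹ u) v := by
    intro u v
    simp only [PiLp.inner_apply, Matrix.toLpLin_apply, Matrix.mulVec, dotProduct,
      RCLike.inner_apply, conj_trivial, Finset.mul_sum]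
    exact Finset.sum_congr rfl fun i _ => Finset.sum_congr rfl fun j _ => mul_comm _ _
  simpa only [hinner] using isBoundedForm_inner_map (Matrix.toEuclideanLin A⁻¹) hbound

/-- The integrand `((w · ∇) u) · v` of the convective form, as a function of the values `a = w(x)`,
`b = v(x)` and of the gradient `G (j, i) = ∂ᵢ uⱼ (x)`. -/
def convection (a : EuclideanSpace ℝ ι) (G : EuclideanSpace ℝ (κ × ι))
    (b : EuclideanSpace ℝ κ) : ℝ :=
  ∑ j, (∑ i, a i * G (j, i)) * b j

theorem abs_convection_le (a : EuclideanSpace ℝ ι) (G : EuclideanSpace ℝ (κ × ι))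
    (b : EuclideanSpace ℝ κ) : |convection a G b| ≤ ‖a‖ * ‖G‖ * ‖b‖ := by
  have hG : ‖G‖ ^ 2 = ∑ j, ∑ i, G (j, i) ^ 2 := by
    rw [EuclideanSpace.real_norm_sq_eq, Fintype.sum_prod_type]
  refine abs_le_of_sq_le_sq ?_ (by positivity)
  calc (convection a G b) ^ 2
      ≤ (∑ j, (∑ i, a i * G (j, i)) ^ 2) * ∑ j, b j ^ 2 := Finset.sum_mul_sq_le_sq_mul_sq _ _ _
    _ ≤ (∑ j, (∑ i, a i ^ 2) * ∑ i, G (j, i) ^ 2) * ∑ j, b j ^ 2 := by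
        gcongr
        exact Finset.sum_mul_sq_le_sq_mul_sq _ _ _
    _ = (‖a‖ * ‖G‖ * ‖b‖) ^ 2 := by
        rw [← Finset.mul_sum, mul_pow, mul_pow, hG, EuclideanSpace.real_norm_sq_eq,
          EuclideanSpace.real_norm_sq_eq]

theorem isBoundedForm_convection (a : EuclideanSpace ℝ ι) :
    IsBoundedForm (fun (G : EuclideanSpace ℝ (κ × ι)) b => convection a G b) ‖a‖ where
  add_left G G' b := by
    simp only [convection, PiLp.add_apply, mul_add, add_mul, Finset.sum_add_distrib]
  smul_left c G b := by
    simp only [convection, PiLp.smul_apply, smul_eq_mul, Finset.mul_sum, Finset.sum_mul]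
    exact Finset.sum_congr rfl fun j _ => Finset.sum_congr rfl fun i _ => by ring
  add_right G b b' := by
    simp only [convection, PiLp.add_apply, mul_add, Finset.sum_add_distrib]
  smul_right c G b := by
    simp only [convection, PiLp.smul_apply, smul_eq_mul, Finset.mul_sum]
    exact Finset.sum_congr rfl fun j _ => by ring
  abs_le := abs_convection_le a

theorem isBoundedForm_convection_left (G : EuclideanSpace ℝ (κ × ι)) :
    IsBoundedForm (fun a b => convection a G b) ‖G‖ where
  add_left a a' b := by
    simp only [convection, PiLp.add_apply, add_mul, Finset.sum_add_distrib]
  smul_left c a b := by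
    simp only [convection, PiLp.smul_apply, smul_eq_mul, Finset.mul_sum, Finset.sum_mul]
    exact Finset.sum_congr rfl fun j _ => Finset.sum_congr rfl fun i _ => by ring
  add_right a b b' := (isBoundedForm_convection a).add_right G b b'
  smul_right c a b := (isBoundedForm_convection a).smul_right c G b
  abs_le a b := by simpa only [mul_comm ‖G‖] using abs_convection_le a G b

end PointwiseForms

/-! ### Norms of values and gradients -/

section EuclideanValued

variable {α ι U : Type*} [MeasurableSpace α] {μ : Measure α}

theorem aestronglyMeasurable_toLp [Finite ι] (f : ι → Lp ℝ 2 μ) :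
    AEStronglyMeasurable (fun x => (WithLp.toLp 2 fun i => f i x : EuclideanSpace ℝ ι)) μ :=
  (PiLp.continuous_toLp 2 _).comp_aestronglyMeasurable (aemeasurable_pi_lambda _ fun i =>
    (Lp.aestronglyMeasurable (f i)).aemeasurable).aestronglyMeasurable

variable [Fintype ι]

theorem eLpNorm_two_sq {E : Type*} [NormedAddCommGroup E] (f : α → E) :
    eLpNorm f 2 μ ^ 2 = ∫⁻ x, ‖f x‖ₑ ^ 2 ∂μ := by
  simpa using eLpNorm_nnreal_pow_eq_lintegral (f := f) (μ := μ) (p := 2) two_ne_zero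

theorem eLpNorm_toLp_two_sq (f : ι → Lp ℝ 2 μ) :
    eLpNorm (fun x => (WithLp.toLp 2 fun i => f i x : EuclideanSpace ℝ ι)) 2 μ ^ 2
      = ∑ i, ‖f i‖ₑ ^ 2 := by
  simp only [Lp.enorm_def, eLpNorm_two_sq]
  rw [← lintegral_finsetSum' _ fun i _ => (Lp.aestronglyMeasurable (f i)).enorm.pow_const 2]
  refine lintegral_congr fun x => ?_
  simp only [← ofReal_norm, ← ENNReal.ofReal_pow (norm_nonneg _)]
  rw [EuclideanSpace.norm_sq_eq, ENNReal.ofReal_sum_of_nonneg fun i _ => by positivity]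

theorem isAELinear_toLp [NormedAddCommGroup U] [NormedSpace ℝ U] (L : U →ₗ[ℝ] ι → Lp ℝ 2 μ) :
    IsAELinear μ fun u x => (WithLp.toLp 2 fun i => L u i x : EuclideanSpace ℝ ι) where
  aestronglyMeasurable u := aestronglyMeasurable_toLp (L u)
  map_add u u' := by
    filter_upwards [ae_all_iff.2 fun i => Lp.coeFn_add (L u i) (L u' i)] with x hx
    ext i
    simpa using hx i
  map_smul c u := by
    filter_upwards [ae_all_iff.2 fun i => Lp.coeFn_smul c (L u i)] with x hx
    ext i
    simpa using hx i

end EuclideanValued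

variable {d m : ℕ} {Ω : Set (Pt d)}

-- Instance search through the nested products and submodules is too slow without these shortcuts.
noncomputable local instance instNormedSpaceH1v : NormedSpace ℝ (H1v Ω m) :=
  inferInstance

noncomputable local instance instInnerProductSpaceH1v : InnerProductSpace ℝ (H1v Ω m) :=
  inferInstance

/-- The gradient `∇w(x)` with entries `(j, i) ↦ ∂ᵢ wⱼ (x)`, as an element of a Euclidean space so
that its norm is the Frobenius norm. -/
noncomputable def gradVec (w : H1v Ω m) (x : Pt d) : EuclideanSpace ℝ (Fin m × Fin d) :=
  WithLp.toLp 2 fun p => grad w p.1 p.2 x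

theorem gradLpNorm_eq (p : ℝ≥0∞) (w : H1v Ω m) :
    gradLpNorm p w = eLpNorm (gradVec w) p (volume.restrict Ω) := by
  rw [← eLpNorm_norm (gradVec w)]
  simp only [gradLpNorm, gradVec, EuclideanSpace.norm_eq, Fintype.sum_prod_type,
    Real.norm_eq_abs, sq_abs]

theorem isAELinear_val : IsAELinear (volume.restrict Ω) (val : H1v Ω m → _) :=
  isAELinear_toLp ⟨⟨fun (w : H1v Ω m) j => (w j : Jet Ω) none, fun _ _ => rfl⟩, fun _ _ => rfl⟩

theorem isAELinear_gradVec : IsAELinear (volume.restrict Ω) (gradVec : H1v Ω m → _) :=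
  isAELinear_toLp ⟨⟨fun (w : H1v Ω m) (p : Fin m × Fin d) => (w p.1 : Jet Ω) (some p.2),
    fun _ _ => rfl⟩, fun _ _ => rfl⟩

theorem norm_sq_H1v (w : H1v Ω m) :
    ‖w‖ ^ 2 = ∑ j, (‖(w j : Jet Ω) none‖ ^ 2 + ∑ i, ‖(w j : Jet Ω) (some i)‖ ^ 2) := by
  rw [PiLp.norm_sq_eq_of_L2]
  exact Finset.sum_congr rfl fun j _ => by
    rw [Submodule.coe_norm, PiLp.norm_sq_eq_of_L2, Fintype.sum_option]

theorem enorm_sq_H1v (w : H1v Ω m) :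
    ‖w‖ₑ ^ 2 = lpNorm 2 w ^ 2 + gradLpNorm 2 w ^ 2 := by
  have henorm :
      ‖w‖ₑ ^ 2 = ∑ j, (‖(w j : Jet Ω) none‖ₑ ^ 2 + ∑ i, ‖(w j : Jet Ω) (some i)‖ₑ ^ 2) := by
    simp only [enorm_eq_nnnorm]
    exact_mod_cast NNReal.coe_injective (by push_cast; exact norm_sq_H1v w)
  have hval : lpNorm 2 w ^ 2 = _ := eLpNorm_toLp_two_sq fun j => (w j : Jet Ω) none
  have hgrad := eLpNorm_toLp_two_sq fun p : Fin m × Fin d => (w p.1 : Jet Ω) (some p.2)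
  rw [henorm, Finset.sum_add_distrib, gradLpNorm_eq, hval]
  exact congrArg _ ((Fintype.sum_prod_type _).symm.trans hgrad.symm)

theorem lpNorm_two_le (w : H1v Ω m) : lpNorm 2 w ≤ ‖w‖ₑ := by
  rw [← ENNReal.pow_le_pow_left_iff two_ne_zero, enorm_sq_H1v]
  exact le_self_add

theorem gradLpNorm_two_le (w : H1v Ω m) : gradLpNorm 2 w ≤ ‖w‖ₑ := by
  rw [← ENNReal.pow_le_pow_left_iff two_ne_zero, enorm_sq_H1v]
  exact le_add_self

theorem eLpNorm_eq_zero_of_eLpNorm_eq_zero {α E : Type*} [MeasurableSpace α] {μ : Measure α}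
    [NormedAddCommGroup E] {f : α → E} (hf : AEStronglyMeasurable f μ) {p : ℝ≥0∞} (q : ℝ≥0∞)
    (hp : p ≠ 0) (h : eLpNorm f p μ = 0) : eLpNorm f q μ = 0 := by
  rw [eLpNorm_congr_ae ((eLpNorm_eq_zero_iff hf hp).1 h), eLpNorm_zero]

theorem le_sInf_mul {ι : Type*} {P : ι → Prop} {a b : ι → ℝ≥0∞} {i : ι} (hi : P i)
    (h0 : b i = 0 → a i = 0) (hb : b i ≠ ⊤) :
    a i ≤ sInf {C | ∀ i, P i → a i ≤ C * b i} * b i := by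
  rcases eq_or_ne (b i) 0 with h | h
  · simp [h0 h]
  · rw [← ENNReal.div_le_iff_le_mul (Or.inl h) (Or.inl hb)]
    exact le_sInf fun C hC => (ENNReal.div_le_iff_le_mul (Or.inl h) (Or.inl hb)).2 (hC i hi)

theorem lpNorm_le_embConst_self (p : ℝ≥0∞) (w : H1v Ω d) :
    lpNorm p w ≤ embConst Ω p * ‖w‖ₑ := by
  have h := le_sInf_mul (P := fun _ => True) (a := fun w : H1v Ω d => lpNorm p w)
    (b := fun w => ‖w‖ₑ) (i := w) trivial (fun h => ?_) enorm_ne_top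
  · simpa only [embConst, true_imp_iff] using h
  · exact eLpNorm_eq_zero_of_eLpNorm_eq_zero (isAELinear_val.aestronglyMeasurable w) p two_ne_zero
      (nonpos_iff_eq_zero.1 ((lpNorm_two_le w).trans_eq h))

theorem lpNorm_le_embConst (hmd : m ≤ d) (p : ℝ≥0∞) (w : H1v Ω m) :
    lpNorm p w ≤ embConst Ω p * ‖w‖ₑ := by
  -- `embConst` refers to fields with `d` components: pad `w` with zeros.
  obtain ⟨k, rfl⟩ := Nat.exists_eq_add_of_le hmd
  let w' : H1v Ω (m + k) := WithLp.toLp 2 (Fin.addCases (fun j => w j) fun _ => 0)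
  have hnorm : ‖w'‖ₑ = ‖w‖ₑ := by
    have : ‖w'‖ = ‖w‖ := by
      rw [← sq_eq_sq₀ (norm_nonneg _) (norm_nonneg _), PiLp.norm_sq_eq_of_L2,
        PiLp.norm_sq_eq_of_L2, Fin.sum_univ_add]
      simp [w']
    rw [← ofReal_norm, this, ofReal_norm]
  have hlpNorm : lpNorm p w' = lpNorm p w := by
    refine eLpNorm_congr_norm_ae ?_
    filter_upwards [Lp.coeFn_zero ℝ 2 (volume.restrict Ω)] with x hx
    have hleft : ∀ i, val w' x (Fin.castAdd k i) = val w x i := by simp [val, w']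
    have hright : ∀ i, val w' x (Fin.natAdd m i) = 0 := fun i => by simpa [val, w'] using hx
    rw [← sq_eq_sq₀ (norm_nonneg _) (norm_nonneg _), EuclideanSpace.norm_sq_eq,
      EuclideanSpace.norm_sq_eq, Fin.sum_univ_add]
    simp [hleft, hright]
  rw [← hnorm, ← hlpNorm]
  exact lpNorm_le_embConst_self p w'

theorem gradLpNorm_le_gradEmbConst {σ : ℝ} (p : ℝ≥0∞) {w : H1v Ω d} (hw : MemFrac σ w) :
    gradLpNorm p w ≤ gradEmbConst Ω σ p * fracNorm σ w := by
  refine le_sInf_mul (P := MemFrac σ) (a := gradLpNorm p) (b := fracNorm σ) hw (fun h => ?_) hw.ne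
  have hnorm : ‖w‖ₑ = 0 := by
    rw [fracNorm, ENNReal.rpow_eq_zero_iff_of_pos one_half_pos, add_eq_zero] at h
    exact pow_eq_zero_iff two_ne_zero |>.1 h.1
  have hgrad := nonpos_iff_eq_zero.1 ((gradLpNorm_two_le w).trans_eq hnorm)
  rw [gradLpNorm_eq] at hgrad ⊢
  exact eLpNorm_eq_zero_of_eLpNorm_eq_zero (isAELinear_gradVec.aestronglyMeasurable w) p
    two_ne_zero hgrad

/-! ### Continuity of the forms of the problem -/

section Continuity

theorem norm_gradVec_sq (w : H1v Ω m) (x : Pt d) :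
    ‖gradVec w x‖ ^ 2 = ∑ j, ∑ i, grad w j i x ^ 2 := by
  rw [EuclideanSpace.real_norm_sq_eq, Fintype.sum_prod_type]
  rfl

theorem aestronglyMeasurable_convection {α ι κ : Type*} [Fintype ι] [Fintype κ]
    [MeasurableSpace α] {μ : Measure α} {a : α → EuclideanSpace ℝ ι}
    {G : α → EuclideanSpace ℝ (κ × ι)} {b : α → EuclideanSpace ℝ κ}
    (ha : AEStronglyMeasurable a μ) (hG : AEStronglyMeasurable G μ)
    (hb : AEStronglyMeasurable b μ) :
    AEStronglyMeasurable (fun x => convection (a x) (G x) (b x)) μ := by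
  unfold convection
  fun_prop

theorem aestronglyMeasurable_val (w : H1v Ω m) :
    AEStronglyMeasurable (val w) (volume.restrict Ω) :=
  isAELinear_val.aestronglyMeasurable w

theorem aestronglyMeasurable_val_apply (w : H1v Ω m) (j : Fin m) :
    AEStronglyMeasurable (fun x => val w x j) (volume.restrict Ω) :=
  Lp.aestronglyMeasurable _

theorem aestronglyMeasurable_gradVec (w : H1v Ω m) :
    AEStronglyMeasurable (gradVec w) (volume.restrict Ω) :=
  isAELinear_gradVec.aestronglyMeasurable w

theorem eLpNorm_gradVec_two_le (w : H1v Ω m) :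
    eLpNorm (gradVec w) 2 (volume.restrict Ω) ≤ ‖w‖ₑ :=
  (gradLpNorm_eq 2 w).symm.trans_le (gradLpNorm_two_le w)

instance holderTriple_six_two : ENNReal.HolderTriple 6 2 (3 / 2) := by
  constructor
  rw [← ENNReal.toReal_eq_toReal_iff' (by finiteness) (by simp),
    ENNReal.toReal_add (by finiteness) (by finiteness)]
  norm_num

instance holderTriple_threeHalves_three : ENNReal.HolderTriple (3 / 2) 3 1 := by
  constructor
  rw [← ENNReal.toReal_eq_toReal_iff' (by simp) (by finiteness),
    ENNReal.toReal_add (by simp) (by finiteness)]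
  norm_num

/-- The constant `C₆ C₃` in `|((w · ∇) u, v)| ≤ C₆ C₃ ‖w‖ ‖u‖ ‖v‖`. -/
noncomputable def convConst (Ω : Set (Pt d)) : ℝ≥0∞ :=
  embConst Ω 6 * embConst Ω 3

theorem isBoundedForm_formC (hmd : m ≤ d) (hC : convConst Ω ≠ ⊤) (w : H1v Ω d) :
    IsBoundedForm (fun u v : H1v Ω m => formC w u v) ((convConst Ω).toReal * ‖w‖) := by
  have hconst : embConst Ω 6 * ‖w‖ₑ * 1 * embConst Ω 3 = convConst Ω * ‖w‖ₑ := by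
    rw [convConst]; ring
  have h := isBoundedForm_integral 2 3 6 (3 / 2) isAELinear_gradVec isAELinear_val
    (ae_of_all _ fun x => isBoundedForm_convection (val w x))
    (fun u v => aestronglyMeasurable_convection (aestronglyMeasurable_val w)
      (aestronglyMeasurable_gradVec u) (aestronglyMeasurable_val v))
    (aestronglyMeasurable_val w).norm
    ((eLpNorm_norm _).trans_le (lpNorm_le_embConst_self 6 w))
    (K := 1) (fun u => by simpa only [one_mul] using eLpNorm_gradVec_two_le u)
    (lpNorm_le_embConst hmd 3) (by rw [hconst]; finiteness)
  rwa [hconst, ENNReal.toReal_mul, toReal_enorm] at h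

theorem isBoundedForm_formC_left (hmd : m ≤ d) (hC : convConst Ω ≠ ⊤) (u : H1v Ω m) :
    IsBoundedForm (fun (w : H1v Ω d) v => formC w u v) ((convConst Ω).toReal * ‖u‖) := by
  have hconst : ‖u‖ₑ * embConst Ω 6 * embConst Ω 3 = convConst Ω * ‖u‖ₑ := by
    rw [convConst]; ring
  have h := isBoundedForm_integral 6 3 2 (3 / 2) isAELinear_val isAELinear_val
    (ae_of_all _ fun x => isBoundedForm_convection_left (gradVec u x))
    (fun w v => aestronglyMeasurable_convection (aestronglyMeasurable_val w)
      (aestronglyMeasurable_gradVec u) (aestronglyMeasurable_val v))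
    (aestronglyMeasurable_gradVec u).norm
    ((eLpNorm_norm _).trans_le (eLpNorm_gradVec_two_le u))
    (lpNorm_le_embConst_self 6) (lpNorm_le_embConst hmd 3) (by rw [hconst]; finiteness)
  rwa [hconst, ENNReal.toReal_mul, toReal_enorm] at h

theorem inner_gradVec (u v : H1v Ω m) (x : Pt d) :
    inner ℝ (gradVec u x) (gradVec v x) = ∑ j, ∑ i, grad u j i x * grad v j i x := by
  simp only [PiLp.inner_apply, Fintype.sum_prod_type, RCLike.inner_apply, conj_trivial, mul_comm,
    gradVec]

theorem formNuT_eq (ν : ℝ → ℝ) (ybar χ : H1v Ω 2) (u v : H1v Ω d) :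
    formNuT ν ybar χ u v = ∫ x in Ω,
      deriv ν (val ybar x 0) * val χ x 0 * inner ℝ (gradVec u x) (gradVec v x) := by
  simp only [inner_gradVec]
  rfl

theorem isBoundedForm_mul_coord_mul_inner {ι E : Type*} [Fintype ι] [NormedAddCommGroup E]
    [InnerProductSpace ℝ E] {c C : ℝ} (hc : |c| ≤ C) (i : ι) (G : E) :
    IsBoundedForm (fun (a : EuclideanSpace ℝ ι) b => c * a i * inner ℝ G b) (C * ‖G‖) where
  add_left a a' b := by rw [PiLp.add_apply]; ring
  smul_left r a b := by rw [PiLp.smul_apply, smul_eq_mul]; ring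
  add_right a b b' := by rw [inner_add_right, mul_add]
  smul_right r a b := by rw [real_inner_smul_right, mul_left_comm]
  abs_le a b := by
    have hC : 0 ≤ C := (abs_nonneg c).trans hc
    calc |c * a i * inner ℝ G b| = |c| * |a i| * |inner ℝ G b| := by rw [abs_mul, abs_mul]
      _ ≤ C * ‖a‖ * (‖G‖ * ‖b‖) := by
          gcongr
          exacts [PiLp.norm_apply_le a i, abs_real_inner_le_norm G b]
      _ = C * ‖G‖ * ‖a‖ * ‖b‖ := by ring

theorem isBoundedForm_mul_inner {E : Type*} [NormedAddCommGroup E] [InnerProductSpace ℝ E]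
    {c C : ℝ} (hc : |c| ≤ C) : IsBoundedForm (fun a b : E => c * inner ℝ a b) C where
  add_left a b x := by rw [inner_add_left, mul_add]
  smul_left r a b := by rw [real_inner_smul_left, mul_left_comm]
  add_right a x y := by rw [inner_add_right, mul_add]
  smul_right r a b := by rw [real_inner_smul_right, mul_left_comm]
  abs_le a b := by
    rw [abs_mul, mul_assoc]
    exact mul_le_mul hc (abs_real_inner_le_norm a b) (abs_nonneg _) ((abs_nonneg c).trans hc)

theorem isBoundedForm_formNuT (hd : 2 ≤ d) {p r : ℝ≥0∞} [ENNReal.HolderTriple r p 2] {ν : ℝ → ℝ}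
    {CνT : ℝ≥0} (hν : Continuous (deriv ν)) (hν' : ∀ t, |deriv ν t| ≤ CνT) (ybar : H1v Ω 2)
    {ubar : H1v Ω d} (h : CνT * gradLpNorm r ubar * embConst Ω p ≠ ⊤) :
    IsBoundedForm (fun χ v => formNuT ν ybar χ ubar v)
      (CνT * gradLpNorm r ubar * embConst Ω p).toReal := by
  have hy := hν.comp_aestronglyMeasurable (aestronglyMeasurable_val_apply ybar 0)
  have hu := aestronglyMeasurable_gradVec ubar
  simpa only [formNuT_eq, mul_one] using isBoundedForm_integral p 2 r 2
    isAELinear_val isAELinear_gradVec (N := CνT * gradLpNorm r ubar) (K' := 1)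
    (ae_of_all _ fun x => isBoundedForm_mul_coord_mul_inner (hν' (val ybar x 0)) 0 (gradVec ubar x))
    (fun χ v => (hy.mul (aestronglyMeasurable_val_apply χ 0)).mul
      (hu.inner (aestronglyMeasurable_gradVec v)))
    (aestronglyMeasurable_const.mul hu.norm)
    ((eLpNorm_const_smul_le (c := (CνT : ℝ))).trans_eq (by simp [gradLpNorm_eq]))
    (lpNorm_le_embConst hd p)
    (fun v => by simpa only [one_mul] using eLpNorm_gradVec_two_le v)
    (by simpa using h)

theorem isBoundedForm_formFy {F : Pt 2 → Pt d} {CFy : ℝ≥0} (hF : Continuous (fderiv ℝ F))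
    (hF' : ∀ z, ‖fderiv ℝ F z‖ ≤ CFy) (ybar : H1v Ω 2) :
    IsBoundedForm (fun χ v => formFy F ybar χ v) CFy := by
  refine isBoundedForm_integral_of_eLpNorm_two_le (J := val) (J' := val)
    (β := fun x a b => inner ℝ (fderiv ℝ F (val ybar x) a) b) CFy.2 isAELinear_val isAELinear_val
    (ae_of_all _ fun x => isBoundedForm_inner_map (fderiv ℝ F (val ybar x)).toLinearMap
      ((fderiv ℝ F (val ybar x)).le_of_opNorm_le (hF' _))) (fun χ v => ?_)
    lpNorm_two_le lpNorm_two_le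
  have hFy := hF.comp_aestronglyMeasurable (aestronglyMeasurable_val ybar)
  exact ((ContinuousLinearMap.id ℝ (Pt 2 →L[ℝ] Pt d)).aestronglyMeasurable_comp₂ hFy
    (aestronglyMeasurable_val χ)).inner (aestronglyMeasurable_val v)

/-- The integrand `∑ i, (D ∂ᵢy) · ∂ᵢs` of the diffusion form, as a function of `G = ∇y(x)` and
`H = ∇s(x)`, with gradients stored as in `gradVec`. -/
def diffusion {ι κ : Type*} [Fintype ι] [Fintype κ] (D : Matrix κ κ ℝ)
    (G H : EuclideanSpace ℝ (κ × ι)) : ℝ :=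
  ∑ i, ∑ k, ∑ l, D k l * G (l, i) * H (k, i)

theorem isBoundedForm_diffusion {ι κ : Type*} [Fintype ι] [Fintype κ] (D : Matrix κ κ ℝ) :
    IsBoundedForm (diffusion (ι := ι) D) (∑ _i : ι, ∑ k, ∑ l, |D k l|) := by
  unfold diffusion
  simpa only [mul_assoc, mul_one] using
    IsBoundedForm.sum Finset.univ fun i => IsBoundedForm.sum Finset.univ fun k =>
      IsBoundedForm.sum Finset.univ fun l =>
        (isBoundedForm_coord_mul_coord (ι := κ × ι) (l, i) (k, i)).const_mul (D k l)

theorem aestronglyMeasurable_diffusion (D : Matrix (Fin m) (Fin m) ℝ) (y s : H1v Ω m) :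
    AEStronglyMeasurable (fun x => diffusion D (gradVec y x) (gradVec s x))
      (volume.restrict Ω) := by
  have hgrad : ∀ (w : H1v Ω m) j i, AEStronglyMeasurable (grad w j i) (volume.restrict Ω) :=
    fun w j i => Lp.aestronglyMeasurable _
  simp only [diffusion, gradVec]
  fun_prop

theorem isBoundedForm_formAy (D : Matrix (Fin 2) (Fin 2) ℝ) :
    IsBoundedForm (formAy (Ω := Ω) D) (∑ _i : Fin d, ∑ k, ∑ l, |D k l|) :=
  isBoundedForm_integral_of_eLpNorm_two_le (by positivity) isAELinear_gradVec
    isAELinear_gradVec (ae_of_all _ fun _ => isBoundedForm_diffusion D)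
    (aestronglyMeasurable_diffusion D) eLpNorm_gradVec_two_le eLpNorm_gradVec_two_le

theorem aestronglyMeasurable_inv_apply {ι α : Type*} [Fintype ι] [DecidableEq ι]
    [MeasurableSpace α] {μ : Measure α} {K : α → Matrix ι ι ℝ}
    (hK : ∀ i j, AEMeasurable (fun x => K x i j) μ) (i j : ι) :
    AEStronglyMeasurable (fun x => (K x)⁻¹ i j) μ := by
  have hKm : AEStronglyMeasurable K μ := (aemeasurable_pi_lambda _ fun i =>
    aemeasurable_pi_lambda _ fun j => hK i j).aestronglyMeasurable
  have hdet : AEStronglyMeasurable (fun x => (K x).det) μ :=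
    continuous_id.matrix_det.comp_aestronglyMeasurable hKm
  have hadj : AEStronglyMeasurable (fun x => (K x).adjugate i j) μ :=
    (continuous_id.matrix_adjugate.matrix_elem i j).comp_aestronglyMeasurable hKm
  simp only [Matrix.inv_def, Ring.inverse_eq_inv', Matrix.smul_apply, smul_eq_mul]
  exact hdet.aemeasurable.inv.aestronglyMeasurable.mul hadj

theorem isBoundedForm_formA (hΩ : IsOpen Ω) {K : Pt d → Matrix (Fin d) (Fin d) ℝ} {κ : ℝ}
    (hKm : ∀ i j, AEMeasurable (fun x => K x i j) (volume.restrict Ω)) (hκ : 0 < κ)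
    (hKpos : ∀ x ∈ Ω, ∀ v : Fin d → ℝ, κ * (v ⬝ᵥ v) ≤ v ⬝ᵥ (K x).mulVec v)
    {ν : ℝ → ℝ} {ν₂ : ℝ} (hν : Continuous ν) (hν₂ : ∀ t, |ν t| ≤ ν₂) (y : H1v Ω 2) :
    IsBoundedForm (formA K ν y) (κ⁻¹ + ν₂) := by
  refine .add (isBoundedForm_integral_of_eLpNorm_two_le (inv_nonneg.2 hκ.le) isAELinear_val
    isAELinear_val ((ae_restrict_mem hΩ.measurableSet).mono fun x hx =>
      isBoundedForm_inv_of_mul_dotProduct_le hκ (hKpos x hx)) (fun u v => ?_)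
    lpNorm_two_le lpNorm_two_le) ?_
  · have hKinv := aestronglyMeasurable_inv_apply hKm
    have := aestronglyMeasurable_val u
    have := aestronglyMeasurable_val v
    fun_prop
  · have hνy := hν.comp_aestronglyMeasurable (aestronglyMeasurable_val_apply y 0)
    simpa only [inner_gradVec] using isBoundedForm_integral_of_eLpNorm_two_le
      ((abs_nonneg _).trans (hν₂ 0)) isAELinear_gradVec isAELinear_gradVec
      (ae_of_all _ fun x => isBoundedForm_mul_inner (hν₂ (val y x 0)))
      (fun u v => hνy.mul ((aestronglyMeasurable_gradVec u).inner (aestronglyMeasurable_gradVec v)))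
      eLpNorm_gradVec_two_le eLpNorm_gradVec_two_le

end Continuity

section TestFunctions

theorem continuous_pderiv {f : Pt d → ℝ} (hf : ContDiff ℝ 1 f) (i : Fin d) :
    Continuous (pderiv i f) :=
  (hf.continuous_fderiv one_ne_zero).clm_apply continuous_const

theorem pderiv_coord_self (i : Fin d) (x : Pt d) : pderiv i (fun y : Pt d => y i) x = 1 := by
  have h : fderiv ℝ (fun y : Pt d => y i) x = EuclideanSpace.proj (𝕜 := ℝ) i :=
    (EuclideanSpace.proj (𝕜 := ℝ) i).hasFDerivAt.fderiv
  simp [pderiv, h]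

theorem pderiv_mul_self {f : Pt d → ℝ} {x : Pt d} (hf : DifferentiableAt ℝ f x) (i : Fin d) :
    pderiv i (f * f) x = 2 * f x * pderiv i f x := by
  simp only [pderiv, fderiv_mul hf hf, add_apply, smul_apply,
    smul_eq_mul]
  ring

namespace IsTest

variable {f φ : Pt d → ℝ}

theorem contDiff_one (hφ : IsTest Ω φ) : ContDiff ℝ 1 φ :=
  hφ.1.of_le (by simp)

theorem zero : IsTest Ω 0 :=
  ⟨contDiff_const, HasCompactSupport.zero, by simp [tsupport]⟩

theorem add (hf : IsTest Ω f) (hφ : IsTest Ω φ) : IsTest Ω (f + φ) :=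
  ⟨hf.1.add hφ.1, hf.2.1.add hφ.2.1, (tsupport_add f φ).trans (union_subset hf.2.2 hφ.2.2)⟩

theorem mul_left (hf : ContDiff ℝ ∞ f) (hφ : IsTest Ω φ) : IsTest Ω (f * φ) :=
  ⟨hf.mul hφ.1, hφ.2.1.mul_left, tsupport_mul_subset_right.trans hφ.2.2⟩

theorem const_smul (c : ℝ) (hφ : IsTest Ω φ) : IsTest Ω (c • φ) :=
  mul_left (contDiff_const (c := c)) hφ

theorem eq_zero (hφ : IsTest Ω φ) {x : Pt d} (hx : x ∉ Ω) : φ x = 0 :=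
  image_eq_zero_of_notMem_tsupport fun h => hx (hφ.2.2 h)

theorem pderiv_eq_zero (hφ : IsTest Ω φ) (i : Fin d) {x : Pt d} (hx : x ∉ Ω) :
    pderiv i φ x = 0 := by
  have h : fderiv ℝ φ x = 0 := image_eq_zero_of_notMem_tsupport fun h =>
    hx (hφ.2.2 (tsupport_fderiv_subset ℝ h))
  simp [pderiv, h]

theorem integral_mul_pderiv (hf : ContDiff ℝ 1 f) (hφ : IsTest Ω φ) (i : Fin d) :
    ∫ x in Ω, f x * pderiv i φ x = - ∫ x in Ω, pderiv i f x * φ x := by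
  rw [setIntegral_eq_integral_of_forall_compl_eq_zero
      (fun x hx => by rw [hφ.pderiv_eq_zero i hx, mul_zero]),
    setIntegral_eq_integral_of_forall_compl_eq_zero
      (fun x hx => by rw [hφ.eq_zero hx, mul_zero])]
  have hφ' : HasCompactSupport (pderiv i φ) := hφ.2.1.fderiv_apply ℝ _
  refine integral_mul_fderiv_eq_neg_fderiv_mul_of_integrable ?_ ?_ ?_
    (fun x _ => hf.differentiable one_ne_zero x)
    (fun x _ => hφ.contDiff_one.differentiable one_ne_zero x)
  · exact ((continuous_pderiv hf i).mul hφ.1.continuous).integrable_of_hasCompactSupport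
      hφ.2.1.mul_left
  · exact (hf.continuous.mul
      (continuous_pderiv hφ.contDiff_one i)).integrable_of_hasCompactSupport hφ'.mul_left
  · exact (hf.continuous.mul hφ.1.continuous).integrable_of_hasCompactSupport hφ.2.1.mul_left

/-- A test function as an element of `H¹(Ω)`, with its classical derivatives as weak ones. -/
noncomputable def toH1 (hφ : IsTest Ω φ) : H1 Ω where
  val := WithLp.toLp 2 fun k =>
    k.elim (hφ.memLp.toLp φ) fun i => (hφ.memLp_pderiv i).toLp (pderiv i φ)
  property ψ hψ i := by
    have hval : ∫ x in Ω, hφ.memLp.toLp φ x * pderiv i ψ x = ∫ x in Ω, φ x * pderiv i ψ x :=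
      integral_congr_ae (hφ.memLp.coeFn_toLp.mul .rfl)
    have hder : ∫ x in Ω, (hφ.memLp_pderiv i).toLp (pderiv i φ) x * ψ x =
        ∫ x in Ω, pderiv i φ x * ψ x :=
      integral_congr_ae ((hφ.memLp_pderiv i).coeFn_toLp.mul .rfl)
    exact (hval.trans (hψ.integral_mul_pderiv hφ.contDiff_one i)).trans (congrArg Neg.neg hder.symm)

theorem toH1_none_ae_eq (hφ : IsTest Ω φ) :
    ((hφ.toH1 : Jet Ω) none : Pt d → ℝ) =ᵐ[volume.restrict Ω] φ :=
  hφ.memLp.coeFn_toLp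

theorem toH1_some_ae_eq (hφ : IsTest Ω φ) (i : Fin d) :
    ((hφ.toH1 : Jet Ω) (some i) : Pt d → ℝ) =ᵐ[volume.restrict Ω] pderiv i φ :=
  (hφ.memLp_pderiv i).coeFn_toLp

theorem toH1_mem_H10 (hφ : IsTest Ω φ) : hφ.toH1 ∈ H10 Ω :=
  Submodule.le_topologicalClosure _ (Submodule.subset_span ⟨φ, hφ, hφ.toH1_none_ae_eq⟩)

end IsTest

theorem exists_mem_H10_ne_zero (hΩ : IsOpen Ω) (hne : Ω.Nonempty) : ∃ u ∈ H10 Ω, u ≠ 0 := by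
  obtain ⟨x, hx⟩ := hne
  obtain ⟨φ, hsupp, hcpt, hsmooth, -, hφx⟩ :=
    exists_contDiff_tsupport_subset (n := ⊤) (hΩ.mem_nhds hx)
  have hφ : IsTest Ω φ := ⟨hsmooth, hcpt, hsupp⟩
  refine ⟨hφ.toH1, hφ.toH1_mem_H10, fun h0 => ?_⟩
  have hzero : φ =ᵐ[volume.restrict Ω] fun _ => 0 := by
    refine hφ.toH1_none_ae_eq.symm.trans ?_
    rw [h0]
    exact Lp.coeFn_zero ℝ 2 _
  have hφx' := Measure.eqOn_of_ae_eq hzero hsmooth.continuous.continuousOn continuousOn_const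
    (by rw [hΩ.interior_eq]; exact subset_closure) hx
  exact one_ne_zero (hφx.symm.trans hφx')

end TestFunctions

section Completeness

theorem integral_mul_eq_inner {μ : Measure (Pt d)} {g : Pt d → ℝ} (hg : MemLp g 2 μ)
    (f : Lp ℝ 2 μ) : ∫ x, f x * g x ∂μ = inner ℝ (hg.toLp g) f := by
  rw [L2.inner_def]
  refine integral_congr_ae ?_
  filter_upwards [hg.coeFn_toLp] with x hx
  simp [hx]

theorem continuous_integral_mul {μ : Measure (Pt d)} {g : Pt d → ℝ} (hg : MemLp g 2 μ) :
    Continuous fun f : Lp ℝ 2 μ => ∫ x, f x * g x ∂μ := by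
  simp only [integral_mul_eq_inner hg]
  exact continuous_const.inner continuous_id

theorem isClosed_H1 (Ω : Set (Pt d)) : IsClosed (H1 Ω : Set (Jet Ω)) := by
  have hset : (H1 Ω : Set (Jet Ω)) = ⋂ (φ) (_ : IsTest Ω φ) (i : Fin d), {w : Jet Ω |
      ∫ x in Ω, w none x * pderiv i φ x = - ∫ x in Ω, w (some i) x * φ x} := by
    ext w; simp only [mem_iInter]; rfl
  rw [hset]
  refine isClosed_iInter fun φ => isClosed_iInter fun hφ => isClosed_iInter fun i => ?_
  exact isClosed_eq
    ((continuous_integral_mul (hφ.memLp_pderiv i)).comp (PiLp.continuous_apply 2 _ none))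
    ((continuous_integral_mul hφ.memLp).comp (PiLp.continuous_apply 2 _ (some i))).neg

instance completeSpace_H1 : CompleteSpace (H1 Ω) := (isClosed_H1 Ω).completeSpace_coe

theorem isClosed_H10v (Ω : Set (Pt d)) (m : ℕ) : IsClosed (H10v Ω m : Set (H1v Ω m)) := by
  have hset : (H10v Ω m : Set (H1v Ω m)) = ⋂ j : Fin m, {w : H1v Ω m | w j ∈ H10 Ω} := by
    ext w; simp only [mem_iInter]; rfl
  rw [hset]
  exact isClosed_iInter fun j => (Submodule.isClosed_topologicalClosure _).preimage
    (PiLp.continuous_apply 2 _ j)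

instance completeSpace_H10v : CompleteSpace (H10v Ω m) := (isClosed_H10v Ω m).completeSpace_coe

theorem isClosed_X (Ω : Set (Pt d)) : IsClosed (X Ω : Set (H1v Ω d)) := by
  have hdiv : Continuous (divergence : H1v Ω d → L2 Ω) :=
    continuous_finsetSum _ fun i _ => (PiLp.continuous_apply 2 _ (some i)).comp
      (continuous_subtype_val.comp (PiLp.continuous_apply 2 _ i))
  exact (isClosed_H10v Ω d).inter (isClosed_eq hdiv continuous_const)

instance completeSpace_X : CompleteSpace (X Ω) := (isClosed_X Ω).completeSpace_coe

end Completeness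

section Density

theorem H1.eq_zero_of_apply_none_eq_zero (hΩ : IsOpen Ω) {u : H1 Ω}
    (h : (u : Jet Ω) none = 0) : u = 0 := by
  refine Subtype.ext (PiLp.ext fun k => ?_)
  rcases k with _ | i
  · exact h
  have hloc : LocallyIntegrableOn ((u : Jet Ω) (some i)) Ω volume :=
    locallyIntegrableOn_of_locallyIntegrable_restrict
      ((Lp.memLp ((u : Jet Ω) (some i))).locallyIntegrable one_le_two)
  have hae := hΩ.ae_eq_zero_of_integral_contDiff_smul_eq_zero hloc fun ψ hψ₁ hψ₂ hψ₃ => by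
    have hψ : IsTest Ω ψ := ⟨hψ₁, hψ₂, hψ₃⟩
    have hweak := u.2 ψ hψ i
    rw [h, integral_mul_eq_inner (hψ.memLp_pderiv i), inner_zero_right, zero_eq_neg] at hweak
    rw [← setIntegral_eq_integral_of_forall_compl_eq_zero (s := Ω)
      (fun x hx => by rw [hψ.eq_zero hx, zero_smul]), ← hweak]
    simp only [smul_eq_mul, mul_comm]
  exact (Lp.eq_zero_iff_ae_eq_zero).2 ((ae_restrict_iff' hΩ.measurableSet).2 hae)

theorem H1.ext_of_apply_none_eq (hΩ : IsOpen Ω) {u v : H1 Ω}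
    (h : (u : Jet Ω) none = (v : Jet Ω) none) : u = v :=
  sub_eq_zero.1 (H1.eq_zero_of_apply_none_eq_zero hΩ (sub_eq_zero.2 h))

theorem mem_closure_range_toH1 (hΩ : IsOpen Ω) {u : H1 Ω} (hu : u ∈ H10 Ω) :
    u ∈ closure {w | ∃ (φ : Pt d → ℝ) (hφ : IsTest Ω φ), w = hφ.toH1} := by
  refine closure_mono (fun v hv => ?_) hu
  obtain ⟨φ, hφ, hvφ⟩ : ∃ φ, IsTest Ω φ ∧
      ((v : Jet Ω) none : Pt d → ℝ) =ᵐ[volume.restrict Ω] φ := by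
    induction hv using Submodule.span_induction with
    | mem _ hw => exact hw
    | zero => exact ⟨0, .zero, Lp.coeFn_zero ℝ 2 _⟩
    | add v w _ _ hv hw =>
      obtain ⟨⟨φ, hφ, hvφ⟩, ⟨ψ, hψ, hwψ⟩⟩ := hv, hw
      exact ⟨φ + ψ, hφ.add hψ, (Lp.coeFn_add _ _).trans (hvφ.add hwψ)⟩
    | smul c v _ hv =>
      obtain ⟨φ, hφ, hvφ⟩ := hv
      exact ⟨c • φ, hφ.const_smul c, (Lp.coeFn_smul c _).trans (hvφ.const_smul c)⟩
  exact ⟨φ, hφ, H1.ext_of_apply_none_eq hΩ (Lp.ext (hvφ.trans hφ.toH1_none_ae_eq.symm))⟩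

theorem H10v_induction (hΩ : IsOpen Ω) {P : H1v Ω m → Prop} (hP : IsClosed {v | P v})
    (htest : ∀ (φ : Fin m → Pt d → ℝ) (hφ : ∀ j, IsTest Ω (φ j)),
      P (WithLp.toLp 2 fun j => (hφ j).toH1))
    {v : H1v Ω m} (hv : v ∈ H10v Ω m) : P v := by
  have hmem : v.ofLp ∈ closure
      (univ.pi fun _ => {w | ∃ (φ : Pt d → ℝ) (hφ : IsTest Ω φ), w = hφ.toH1}) := by
    rw [closure_pi_set]
    exact fun j _ => mem_closure_range_toH1 hΩ (hv j)
  refine hP.closure_subset (map_mem_closure (PiLp.continuous_toLp 2 _) hmem fun u hu => ?_)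
  choose φ hφ huφ using fun j => hu j (mem_univ j)
  obtain rfl : u = fun j => (hφ j).toH1 := funext huφ
  exact htest φ hφ

end Density

section Poincare

theorem norm_sq_eq_integral_of_ae_eq {f : L2 Ω} {g : Pt d → ℝ} (h : f =ᵐ[volume.restrict Ω] g) :
    ‖f‖ ^ 2 = ∫ x in Ω, g x ^ 2 := by
  rw [← real_inner_self_eq_norm_sq, L2.inner_def]
  refine integral_congr_ae ?_
  filter_upwards [h] with x hx
  simp [hx, pow_two]

theorem IsTest.integral_sq_eq {φ : Pt d → ℝ} (hφ : IsTest Ω φ) (i : Fin d) :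
    ∫ x in Ω, φ x ^ 2 = - ∫ x in Ω, x i * (2 * φ x * pderiv i φ x) := by
  have hcoord : ContDiff ℝ 1 fun x : Pt d => x i := (EuclideanSpace.proj (𝕜 := ℝ) i).contDiff
  have h := (IsTest.mul_left hφ.1 hφ).integral_mul_pderiv hcoord i
  have hφ' : Differentiable ℝ φ := hφ.contDiff_one.differentiable one_ne_zero
  simp only [pderiv_coord_self, pderiv_mul_self (hφ' _), one_mul, Pi.mul_apply] at h
  simp only [h, neg_neg, pow_two]

theorem IsTest.integral_sq_le {φ : Pt d → ℝ} (hφ : IsTest Ω φ) (hΩ : MeasurableSet Ω) {i : Fin d}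
    {R : ℝ} (hR : ∀ x ∈ Ω, |x i| ≤ R) :
    ∫ x in Ω, φ x ^ 2 ≤ 4 * R ^ 2 * ∫ x in Ω, pderiv i φ x ^ 2 := by
  have hφ₂ : Integrable (fun x => φ x ^ 2 / 2) (volume.restrict Ω) :=
    hφ.memLp.integrable_sq.div_const 2
  have hd₂ : Integrable (fun x => 2 * R ^ 2 * pderiv i φ x ^ 2) (volume.restrict Ω) :=
    (hφ.memLp_pderiv i).integrable_sq.const_mul _
  have hcont : Continuous fun x : Pt d => -(x i * (2 * φ x * pderiv i φ x)) := by
    have := hφ.1.continuous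
    have := continuous_pderiv hφ.contDiff_one i
    fun_prop
  have hint : Integrable (fun x : Pt d => -(x i * (2 * φ x * pderiv i φ x)))
      (volume.restrict Ω) :=
    (hcont.integrable_of_hasCompactSupport
      (hφ.2.1.mono fun x hx hx0 => hx (by simp [hx0]))).restrict
  have hle : ∫ x in Ω, φ x ^ 2 ≤ ∫ x in Ω, (φ x ^ 2 / 2 + 2 * R ^ 2 * pderiv i φ x ^ 2) := by
    rw [hφ.integral_sq_eq i, ← integral_neg]
    refine setIntegral_mono_on hint (hφ₂.add hd₂) hΩ fun x hx => ?_
    have hxR : x i ^ 2 ≤ R ^ 2 := sq_le_sq.2 ((hR x hx).trans (le_abs_self R))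
    nlinarith [sq_nonneg (φ x + 2 * x i * pderiv i φ x),
      mul_le_mul_of_nonneg_right hxR (sq_nonneg (pderiv i φ x))]
  rw [integral_add hφ₂ hd₂, integral_div, integral_const_mul] at hle
  linarith

theorem norm_sq_apply_none_le_of_mem_H10v (hΩ : IsOpen Ω) {i : Fin d} {R : ℝ}
    (hR : ∀ x ∈ Ω, |x i| ≤ R) {v : H1v Ω m} (hv : v ∈ H10v Ω m) (j : Fin m) :
    ‖(v j : Jet Ω) none‖ ^ 2 ≤ 4 * R ^ 2 * ‖(v j : Jet Ω) (some i)‖ ^ 2 := by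
  have hcont (k) : Continuous fun v : H1v Ω m => ‖(v j : Jet Ω) k‖ ^ 2 :=
    (((PiLp.continuous_apply 2 _ k).comp continuous_subtype_val).comp
      (PiLp.continuous_apply 2 _ j)).norm.pow 2
  refine H10v_induction (P := fun v => ‖(v j : Jet Ω) none‖ ^ 2 ≤
    4 * R ^ 2 * ‖(v j : Jet Ω) (some i)‖ ^ 2) hΩ
    (isClosed_le (hcont none) ((hcont (some i)).const_mul _)) (fun φ hφ => ?_) hv
  rw [norm_sq_eq_integral_of_ae_eq (hφ j).toH1_none_ae_eq,
    norm_sq_eq_integral_of_ae_eq ((hφ j).toH1_some_ae_eq i)]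
  exact (hφ j).integral_sq_le hΩ.measurableSet hR

end Poincare

section SkewSymmetry

theorem sum_integral_mul_pderiv_eq_zero {w : H1v Ω d} (hw : divergence w = 0) {φ : Pt d → ℝ}
    (hφ : IsTest Ω φ) : ∑ i, ∫ x in Ω, val w x i * pderiv i φ x = 0 := by
  calc ∑ i, ∫ x in Ω, val w x i * pderiv i φ x
      = ∑ i, -inner ℝ (hφ.memLp.toLp φ) ((w i : Jet Ω) (some i)) := by
        refine Finset.sum_congr rfl fun i _ => ((w i).2 φ hφ i).trans ?_
        rw [integral_mul_eq_inner hφ.memLp]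
    _ = -inner ℝ (hφ.memLp.toLp φ) (divergence w) := by
        rw [Finset.sum_neg_distrib, ← inner_sum, divergence]
    _ = 0 := by rw [hw, inner_zero_right, neg_zero]

theorem formC_toH1_self_eq_zero {w : H1v Ω d} (hw : divergence w = 0) {φ : Fin m → Pt d → ℝ}
    (hφ : ∀ j, IsTest Ω (φ j)) :
    formC w (WithLp.toLp 2 fun j => (hφ j).toH1) (WithLp.toLp 2 fun j => (hφ j).toH1) = 0 := by
  have hsq (j) : IsTest Ω (φ j * φ j) := .mul_left (hφ j).1 (hφ j)
  have hint (j i) : Integrable (fun x => val w x i * pderiv i (φ j * φ j) x)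
      (volume.restrict Ω) := (Lp.memLp ((w i : Jet Ω) none)).integrable_mul ((hsq j).memLp_pderiv i)
  have hval : ∀ᵐ x ∂volume.restrict Ω, ∀ j, ((hφ j).toH1 : Jet Ω) none x = φ j x :=
    ae_all_iff.2 fun j => (hφ j).toH1_none_ae_eq
  have hgrad : ∀ᵐ x ∂volume.restrict Ω, ∀ j i,
      ((hφ j).toH1 : Jet Ω) (some i) x = pderiv i (φ j) x :=
    ae_all_iff.2 fun j => ae_all_iff.2 fun i => (hφ j).toH1_some_ae_eq i
  calc formC w (WithLp.toLp 2 fun j => (hφ j).toH1) (WithLp.toLp 2 fun j => (hφ j).toH1)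
      = ∫ x in Ω, ∑ j, ∑ i, 2⁻¹ * (val w x i * pderiv i (φ j * φ j) x) := by
        refine integral_congr_ae ?_
        filter_upwards [hval, hgrad] with x hx hx'
        refine Finset.sum_congr rfl fun j _ => ?_
        rw [Finset.sum_mul]
        refine Finset.sum_congr rfl fun i _ => ?_
        have hdiff : DifferentiableAt ℝ (φ j) x :=
          (hφ j).contDiff_one.differentiable one_ne_zero x
        simp only [val, grad, hx, hx', pderiv_mul_self hdiff]
        ring
    _ = ∑ j, 2⁻¹ * ∑ i, ∫ x in Ω, val w x i * pderiv i (φ j * φ j) x := by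
        rw [integral_finsetSum _ fun j _ =>
          integrable_finsetSum _ fun i _ => (hint j i).const_mul _]
        refine Finset.sum_congr rfl fun j _ => ?_
        rw [integral_finsetSum _ fun i _ => (hint j i).const_mul _, Finset.mul_sum]
        simp only [integral_const_mul]
    _ = 0 := by simp only [sum_integral_mul_pderiv_eq_zero hw (hsq _), mul_zero,
        Finset.sum_const_zero]

theorem formC_self_eq_zero (hΩ : IsOpen Ω) (hmd : m ≤ d) (hC : convConst Ω ≠ ⊤) {w : H1v Ω d}
    (hw : divergence w = 0) {v : H1v Ω m} (hv : v ∈ H10v Ω m) : formC w v v = 0 := by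
  have hcont : Continuous fun v : H1v Ω m => formC w v v :=
    (isBoundedForm_formC hmd hC w).toCLM.continuous.clm_apply continuous_id
  exact H10v_induction hΩ (isClosed_eq hcont continuous_const)
    (fun _ hφ => formC_toH1_self_eq_zero hw hφ) hv

end SkewSymmetry

/-! ### Coercivity and the smallness condition -/

section Coercivity

theorem integral_norm_gradVec_sq (w : H1v Ω m) :
    ∫ x in Ω, ‖gradVec w x‖ ^ 2 = ∑ j, ∑ i, ‖(w j : Jet Ω) (some i)‖ ^ 2 := by
  have hint : ∀ j i, Integrable (fun x => grad w j i x ^ 2) (volume.restrict Ω) :=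
    fun j i => (Lp.memLp _).integrable_sq
  simp only [norm_gradVec_sq]
  rw [integral_finsetSum _ fun j _ => integrable_finsetSum _ fun i _ => hint j i]
  refine Finset.sum_congr rfl fun j _ => ?_
  rw [integral_finsetSum _ fun i _ => hint j i]
  exact Finset.sum_congr rfl fun i _ => (norm_sq_eq_integral_of_ae_eq .rfl).symm

theorem norm_sq_le_mul_integral_norm_gradVec_sq (hΩ : IsOpen Ω) {i : Fin d} {R : ℝ}
    (hR : ∀ x ∈ Ω, |x i| ≤ R) {v : H1v Ω m} (hv : v ∈ H10v Ω m) :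
    ‖v‖ ^ 2 ≤ (4 * R ^ 2 + 1) * ∫ x in Ω, ‖gradVec v x‖ ^ 2 := by
  rw [norm_sq_H1v, integral_norm_gradVec_sq, Finset.mul_sum]
  refine Finset.sum_le_sum fun j _ => ?_
  have hi : ‖(v j : Jet Ω) (some i)‖ ^ 2 ≤ ∑ k, ‖(v j : Jet Ω) (some k)‖ ^ 2 :=
    Finset.single_le_sum (f := fun k => ‖(v j : Jet Ω) (some k)‖ ^ 2) (fun k _ => sq_nonneg _)
      (Finset.mem_univ i)
  rw [add_mul, one_mul]
  gcongr
  exact (norm_sq_apply_none_le_of_mem_H10v hΩ hR hv j).trans (by gcongr)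

theorem mul_norm_sq_le_diffusion {ι κ : Type*} [Fintype ι] [Fintype κ] {D : Matrix κ κ ℝ} {α : ℝ}
    (hD : ∀ s : κ → ℝ, α * (s ⬝ᵥ s) ≤ s ⬝ᵥ D.mulVec s) (G : EuclideanSpace ℝ (κ × ι)) :
    α * ‖G‖ ^ 2 ≤ diffusion D G G := by
  rw [EuclideanSpace.real_norm_sq_eq, Fintype.sum_prod_type_right, Finset.mul_sum]
  refine Finset.sum_le_sum fun i _ => ?_
  have h := hD fun k => G (k, i)
  simp only [dotProduct, Matrix.mulVec, Finset.mul_sum, ← sq] at h ⊢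
  exact h.trans_eq (Finset.sum_congr rfl fun k _ => Finset.sum_congr rfl fun l _ => mul_comm _ _)

theorem mul_norm_sq_le_formAy (hΩ : IsOpen Ω) {i : Fin d} {R : ℝ} (hR : ∀ x ∈ Ω, |x i| ≤ R)
    {D : Matrix (Fin 2) (Fin 2) ℝ} {α : ℝ} (hα : 0 ≤ α)
    (hD : ∀ s : Fin 2 → ℝ, α * (s ⬝ᵥ s) ≤ s ⬝ᵥ D.mulVec s) {s : H1v Ω 2} (hs : s ∈ H10v Ω 2) :
    α / (4 * R ^ 2 + 1) * ‖s‖ ^ 2 ≤ formAy D s s := by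
  have hgrad : Integrable (fun x => ‖gradVec s x‖ ^ 2) (volume.restrict Ω) :=
    MemLp.integrable_norm_pow (p := 2) ⟨aestronglyMeasurable_gradVec s,
      (eLpNorm_gradVec_two_le s).trans_lt (by finiteness)⟩ two_ne_zero
  have hdiff : Integrable (fun x => diffusion D (gradVec s x) (gradVec s x))
      (volume.restrict Ω) :=
    (hgrad.const_mul (∑ _i : Fin d, ∑ k, ∑ l, |D k l|)).mono' (aestronglyMeasurable_diffusion D s s)
      (ae_of_all _ fun x => by
        simpa only [mul_assoc, ← sq, Real.norm_eq_abs] using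
          (isBoundedForm_diffusion D).abs_le (gradVec s x) (gradVec s x))
  calc α / (4 * R ^ 2 + 1) * ‖s‖ ^ 2
      ≤ α / (4 * R ^ 2 + 1) * ((4 * R ^ 2 + 1) * ∫ x in Ω, ‖gradVec s x‖ ^ 2) := by
        gcongr
        exact norm_sq_le_mul_integral_norm_gradVec_sq hΩ hR hs
    _ = ∫ x in Ω, α * ‖gradVec s x‖ ^ 2 := by
        rw [← mul_assoc, div_mul_cancel₀ _ (by positivity), integral_const_mul]
    _ ≤ formAy D s s := integral_mono (hgrad.const_mul α) hdiff
        fun x => mul_norm_sq_le_diffusion hD _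

theorem coercAy_ne_zero (hΩ : IsOpen Ω) {i : Fin d} {R : ℝ} (hR : ∀ x ∈ Ω, |x i| ≤ R)
    {D : Matrix (Fin 2) (Fin 2) ℝ}
    (hD : ∃ α > 0, ∀ s : Fin 2 → ℝ, α * (s ⬝ᵥ s) ≤ s ⬝ᵥ D.mulVec s) : coercAy Ω D ≠ 0 := by
  obtain ⟨α, hα, hD⟩ := hD
  have hβ : 0 < α / (4 * R ^ 2 + 1) := by positivity
  refine ((ENNReal.ofReal_pos.2 hβ).trans_le (le_sSup fun s => ?_)).ne'
  rw [← ofReal_norm, ← ENNReal.ofReal_pow (norm_nonneg _), ← ENNReal.ofReal_mul hβ.le]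
  exact ENNReal.ofReal_le_ofReal (mul_norm_sq_le_formAy hΩ hR hα.le hD s.2)

theorem coercA_mul_le (K : Pt d → Matrix (Fin d) (Fin d) ℝ) (ν : ℝ → ℝ) (y : H1v Ω 2)
    (v : H10v Ω d) : coercA Ω K ν * ‖v‖ₑ ^ 2 ≤ ENNReal.ofReal (formA K ν y v v) := by
  rw [coercA, ENNReal.sSup_mul]
  exact iSup₂_le fun α hα => hα y v

theorem coercAy_mul_le (D : Matrix (Fin 2) (Fin 2) ℝ) (s : H10v Ω 2) :
    coercAy Ω D * ‖s‖ₑ ^ 2 ≤ ENNReal.ofReal (formAy D (s : H1v Ω 2) s) := by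
  rw [coercAy, ENNReal.sSup_mul]
  exact iSup₂_le fun α hα => hα s

theorem nontrivial_H10v (hΩ : IsOpen Ω) (hne : Ω.Nonempty) (hm : m ≠ 0) :
    Nontrivial (H10v Ω m) := by
  obtain ⟨u, hu, hu0⟩ := exists_mem_H10_ne_zero hΩ hne
  refine ⟨⟨WithLp.toLp 2 fun _ => u, fun _ => hu⟩, 0, fun h => hu0 ?_⟩
  have h' := congrArg (fun v : H10v Ω m => (v : H1v Ω m) ⟨0, Nat.pos_of_ne_zero hm⟩) h
  exact h'

theorem ne_top_of_mul_enorm_sq_le {V : Type*} [NormedAddCommGroup V] [Nontrivial V]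
    {q : V → ℝ} {c : ℝ≥0∞} (h : ∀ v, c * ‖v‖ₑ ^ 2 ≤ ENNReal.ofReal (q v)) : c ≠ ⊤ := by
  rintro rfl
  obtain ⟨v, hv⟩ := exists_ne (0 : V)
  have hv' := h v
  rw [ENNReal.top_mul (pow_ne_zero 2 (enorm_ne_zero.2 hv))] at hv'
  exact ENNReal.ofReal_ne_top (top_le_iff.1 hv')

theorem IsBoundedForm.toReal_mul_norm_sq_le {V : Type*} [NormedAddCommGroup V] [NormedSpace ℝ V]
    {B : V → V → ℝ} {C : ℝ} (hB : IsBoundedForm B C) {c : ℝ≥0∞} (hc : c ≠ 0) {v : V}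
    (h : c * ‖v‖ₑ ^ 2 ≤ ENNReal.ofReal (B v v)) : c.toReal * ‖v‖ ^ 2 ≤ B v v := by
  rcases eq_or_ne v 0 with rfl | hv
  · have h0 := hB.abs_le 0 0
    rw [norm_zero, mul_zero, abs_nonpos_iff] at h0
    simp [h0]
  · have hpos : 0 < B v v := ENNReal.ofReal_pos.1 <| h.trans_lt' <| pos_iff_ne_zero.2 <|
      mul_ne_zero hc (pow_ne_zero 2 (enorm_ne_zero.2 hv))
    simpa using ENNReal.toReal_le_of_le_ofReal hpos.le h

theorem embConst_ne_zero (hΩ : IsOpen Ω) (hne : Ω.Nonempty) (hd : d ≠ 0) {p : ℝ≥0∞} (hp : p ≠ 0) :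
    embConst Ω p ≠ 0 := by
  intro h
  have := nontrivial_H10v hΩ hne hd
  obtain ⟨v, hv⟩ := exists_ne (0 : H10v Ω d)
  have hval : val (v : H1v Ω d) =ᵐ[volume.restrict Ω] 0 := by
    rw [← eLpNorm_eq_zero_iff (aestronglyMeasurable_val _) hp, ← nonpos_iff_eq_zero]
    exact (lpNorm_le_embConst_self p (v : H1v Ω d)).trans_eq (by rw [h, zero_mul])
  refine hv (Subtype.ext (PiLp.ext fun j => (H1.eq_zero_of_apply_none_eq_zero hΩ ?_)))
  rw [Lp.eq_zero_iff_ae_eq_zero]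
  filter_upwards [hval] with x hx
  exact congrArg (fun z : EuclideanSpace ℝ (Fin d) => z j) hx

end Coercivity

section SmallnessCondition

/-- The constant `C_{ν_T} C_{p₂} C_gn M` in `|(ν_T(T̄) χ^T ∇ū, ∇v)| ≤ C_{ν_T} C_{p₂} C_gn M ‖χ‖ ‖v‖`
for `‖ū‖_{3/2+δ} ≤ M`. -/
noncomputable def nuTConst (Ω : Set (Pt d)) (δ : ℝ) (CνT M : ℝ≥0) : ℝ≥0∞ :=
  CνT * embConst Ω (ENNReal.ofReal (p₂ d δ))
    * gradEmbConst Ω (1 / 2 + δ) (ENNReal.ofReal (p₁ d δ)) * M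

theorem holderTriple_p₁_p₂ (hd : 2 ≤ d) {δ : ℝ} (hδ : δ ∈ Ioo (0 : ℝ) (1 / 2)) :
    ENNReal.HolderTriple (ENNReal.ofReal (p₁ d δ)) (ENNReal.ofReal (p₂ d δ)) 2 := by
  obtain ⟨hδ₀, hδ₁⟩ := hδ
  have hd' : (2 : ℝ) ≤ d := by exact_mod_cast hd
  have hden₁ : 0 < (d : ℝ) - 1 - 2 * δ := by linarith
  have : 0 < 1 + 2 * δ := by linarith
  have hp₁ : 0 < p₁ d δ := by unfold p₁; positivity
  have hp₂ : 0 < p₂ d δ := by unfold p₂; positivity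
  have hsum : (p₁ d δ)⁻¹ + (p₂ d δ)⁻¹ = (2 : ℝ)⁻¹ := by
    unfold p₁ p₂
    field_simp
    ring
  constructor
  rw [← ENNReal.ofReal_inv_of_pos hp₁, ← ENNReal.ofReal_inv_of_pos hp₂,
    ← ENNReal.ofReal_add (by positivity) (by positivity), hsum, ENNReal.ofReal_inv_of_pos two_pos,
    ENNReal.ofReal_ofNat]

namespace Smallness

variable {K : Pt d → Matrix (Fin d) (Fin d) ℝ} {ν : ℝ → ℝ} {D : Matrix (Fin 2) (Fin 2) ℝ} {δ : ℝ}
  {CνT CFy Mu My M : ℝ≥0}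

theorem convConst_mul_lt (h : Smallness Ω K ν D δ CνT CFy Mu My M) :
    convConst Ω * (nuTConst Ω δ CνT M * My / coercAy Ω D + Mu + CFy * My / coercAy Ω D)
      < coercA Ω K ν := h

theorem coercA_ne_zero (h : Smallness Ω K ν D δ CνT CFy Mu My M) : coercA Ω K ν ≠ 0 :=
  h.convConst_mul_lt.ne_bot

theorem convConst_ne_top (h : Smallness Ω K ν D δ CνT CFy Mu My M) (hMu : 0 < Mu) :
    convConst Ω ≠ ⊤ := fun hC => by
  have hlt := h.convConst_mul_lt
  rw [hC, ENNReal.top_mul (by simp [hMu.ne'])] at hlt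
  exact not_top_lt hlt

theorem nuTConst_ne_top (h : Smallness Ω K ν D δ CνT CFy Mu My M) (hMy : 0 < My)
    (hC : convConst Ω ≠ 0) (hα : coercAy Ω D ≠ ⊤) : nuTConst Ω δ CνT M ≠ ⊤ := fun hG => by
  have hlt := h.convConst_mul_lt
  rw [hG, ENNReal.top_mul (by simpa using hMy.ne'), ENNReal.top_div_of_ne_top hα, top_add, top_add,
    ENNReal.mul_top hC] at hlt
  exact not_top_lt hlt

theorem toReal_mul_lt (h : Smallness Ω K ν D δ CνT CFy Mu My M) (hC : convConst Ω ≠ ⊤)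
    (hG : nuTConst Ω δ CνT M ≠ ⊤) (hα₀ : coercAy Ω D ≠ 0) (hα : coercAy Ω D ≠ ⊤)
    (hA : coercA Ω K ν ≠ ⊤) :
    ((nuTConst Ω δ CνT M).toReal + CFy) * ((convConst Ω).toReal * My)
      < ((coercA Ω K ν).toReal - (convConst Ω).toReal * Mu) * (coercAy Ω D).toReal := by
  have hlt := h.convConst_mul_lt
  lift convConst Ω to ℝ≥0 using hC with C
  lift nuTConst Ω δ CνT M to ℝ≥0 using hG with G
  lift coercAy Ω D to ℝ≥0 using hα with α
  lift coercA Ω K ν to ℝ≥0 using hA with A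
  have hα_ne : α ≠ 0 := by exact_mod_cast hα₀
  have hα_pos : (0 : ℝ) < α := by exact_mod_cast hα_ne.bot_lt
  simp only [← ENNReal.coe_mul, ← ENNReal.coe_div hα_ne, ← ENNReal.coe_add, ENNReal.coe_lt_coe]
    at hlt
  have hlt' : (C : ℝ) * (G * My / α + Mu + CFy * My / α) < A := by exact_mod_cast hlt
  have hsplit : (C : ℝ) * (G * My / α + Mu + CFy * My / α)
      = C * Mu + (G + CFy) * (C * My) / α := by ring
  rwa [hsplit, ← lt_sub_iff_add_lt', div_lt_iff₀ hα_pos] at hlt'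

end Smallness

end SmallnessCondition

/-! ### The linearized equations -/

section Linearized

/-- The part of the linearized momentum equation acting on the velocity. -/
noncomputable def momentumForm (K : Pt d → Matrix (Fin d) (Fin d) ℝ) (ν : ℝ → ℝ) (ubar : H1v Ω d)
    (ybar : H1v Ω 2) (u v : H1v Ω d) : ℝ :=
  formA K ν ybar u v + formC u ubar v + formC ubar u v

/-- The part of the linearized momentum equation acting on temperature and salinity. -/
noncomputable def couplingForm (ν : ℝ → ℝ) (F : Pt 2 → Pt d) (ubar : H1v Ω d) (ybar χ : H1v Ω 2)
    (v : H1v Ω d) : ℝ :=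
  formNuT ν ybar χ ubar v - formFy F ybar χ v

/-- The part of the linearized transport equations acting on temperature and salinity. -/
noncomputable def transportForm (D : Matrix (Fin 2) (Fin 2) ℝ) (ubar : H1v Ω d)
    (χ s : H1v Ω 2) : ℝ :=
  formAy D χ s + formC ubar χ s

variable {K : Pt d → Matrix (Fin d) (Fin d) ℝ} {ν : ℝ → ℝ} {F : Pt 2 → Pt d}
  {D : Matrix (Fin 2) (Fin 2) ℝ} {ubar : H1v Ω d} {ybar : H1v Ω 2}

theorem isLinearizedSolution_iff {fhat : StrongDual ℝ (X Ω)} {ftil : StrongDual ℝ (H10v Ω 2)}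
    {ψ : X Ω} {χ : H10v Ω 2} :
    IsLinearizedSolution K ν F D ubar ybar fhat ftil ψ χ ↔
      (∀ v : X Ω, momentumForm K ν ubar ybar ψ v + couplingForm ν F ubar ybar χ v = fhat v) ∧
        ∀ s : H10v Ω 2, transportForm D ubar χ s + formC (ψ : H1v Ω d) ybar s = ftil s := by
  simp only [IsLinearizedSolution, momentumForm, couplingForm, transportForm, add_sub_assoc]

theorem isBoundedForm_momentumForm (hC : convConst Ω ≠ ⊤) {A : ℝ}
    (hA : IsBoundedForm (formA (Ω := Ω) K ν ybar) A) :
    IsBoundedForm (momentumForm K ν ubar ybar)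
      (A + (convConst Ω).toReal * ‖ubar‖ + (convConst Ω).toReal * ‖ubar‖) :=
  (hA.add (isBoundedForm_formC_left le_rfl hC ubar)).add (isBoundedForm_formC le_rfl hC ubar)

theorem mul_norm_sq_le_momentumForm (hΩ : IsOpen Ω) (hC : convConst Ω ≠ ⊤) {A : ℝ}
    (hA : IsBoundedForm (formA (Ω := Ω) K ν ybar) A) (hcoer : coercA Ω K ν ≠ 0) {Mu : ℝ≥0}
    (hubar : divergence ubar = 0) (hMu : ‖ubar‖ ≤ Mu) (u : X Ω) :
    ((coercA Ω K ν).toReal - (convConst Ω).toReal * Mu) * ‖u‖ ^ 2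
      ≤ momentumForm K ν ubar ybar u u := by
  have hformA : (coercA Ω K ν).toReal * ‖u‖ ^ 2 ≤ formA K ν ybar u u :=
    hA.toReal_mul_norm_sq_le hcoer (coercA_mul_le K ν ybar ⟨u, u.2.1⟩)
  have hskew : formC ubar (u : H1v Ω d) u = 0 := formC_self_eq_zero hΩ le_rfl hC hubar u.2.1
  have hconv : |formC (u : H1v Ω d) ubar (u : H1v Ω d)| ≤ (convConst Ω).toReal * Mu * ‖u‖ ^ 2 :=
    calc _ ≤ (convConst Ω).toReal * ‖ubar‖ * ‖u‖ * ‖u‖ :=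
          (isBoundedForm_formC_left le_rfl hC ubar).abs_le u u
      _ ≤ (convConst Ω).toReal * Mu * ‖u‖ ^ 2 := by rw [mul_assoc _ ‖u‖, ← sq]; gcongr
  rw [momentumForm, hskew]
  linarith [neg_le_of_abs_le hconv]

theorem isBoundedForm_couplingForm (hd : 2 ≤ d) {δ : ℝ} (hδ : δ ∈ Ioo (0 : ℝ) (1 / 2))
    {CνT CFy M : ℝ≥0} (hν : Continuous (deriv ν)) (hν' : ∀ t, |deriv ν t| ≤ CνT)
    (hF : Continuous (fderiv ℝ F)) (hF' : ∀ z, ‖fderiv ℝ F z‖ ≤ CFy)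
    (hG : nuTConst Ω δ CνT M ≠ ⊤) (hM : fracNorm (1 / 2 + δ) ubar ≤ M) :
    IsBoundedForm (couplingForm ν F ubar ybar) ((nuTConst Ω δ CνT M).toReal + CFy) := by
  have := holderTriple_p₁_p₂ hd hδ
  have hgrad : gradLpNorm (ENNReal.ofReal (p₁ d δ)) ubar
      ≤ gradEmbConst Ω (1 / 2 + δ) (ENNReal.ofReal (p₁ d δ)) * M :=
    (gradLpNorm_le_gradEmbConst _ (hM.trans_lt ENNReal.coe_lt_top)).trans (by gcongr)
  have hle : CνT * gradLpNorm (ENNReal.ofReal (p₁ d δ)) ubar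
      * embConst Ω (ENNReal.ofReal (p₂ d δ)) ≤ nuTConst Ω δ CνT M :=
    calc _ ≤ CνT * (gradEmbConst Ω (1 / 2 + δ) (ENNReal.ofReal (p₁ d δ)) * M)
          * embConst Ω (ENNReal.ofReal (p₂ d δ)) := by gcongr
      _ = nuTConst Ω δ CνT M := by rw [nuTConst]; ring
  exact ((isBoundedForm_formNuT hd hν hν' ybar (ne_top_of_le_ne_top hG hle)).mono
    (ENNReal.toReal_mono hG hle)).sub (isBoundedForm_formFy hF hF' ybar)

theorem isBoundedForm_transportForm (hd : 2 ≤ d) (hC : convConst Ω ≠ ⊤) :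
    IsBoundedForm (transportForm D ubar)
      (∑ _i : Fin d, ∑ k, ∑ l, |D k l| + (convConst Ω).toReal * ‖ubar‖) :=
  (isBoundedForm_formAy D).add (isBoundedForm_formC hd hC ubar)

theorem mul_norm_sq_le_transportForm (hΩ : IsOpen Ω) (hd : 2 ≤ d) (hC : convConst Ω ≠ ⊤)
    (hcoer : coercAy Ω D ≠ 0) (hubar : divergence ubar = 0) (s : H10v Ω 2) :
    (coercAy Ω D).toReal * ‖s‖ ^ 2 ≤ transportForm D ubar s s := by
  rw [transportForm, formC_self_eq_zero hΩ hd hC hubar s.2, add_zero]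
  exact (isBoundedForm_formAy D).toReal_mul_norm_sq_le hcoer (coercAy_mul_le D s)

theorem linearizedSystem_wellPosed (hΩ : IsOpen Ω) (hd : 2 ≤ d) {δ : ℝ}
    (hδ : δ ∈ Ioo (0 : ℝ) (1 / 2)) {CνT CFy Mu My M : ℝ≥0}
    (hsmall : Smallness Ω K ν D δ CνT CFy Mu My M) (hC : convConst Ω ≠ ⊤)
    (hG : nuTConst Ω δ CνT M ≠ ⊤) (hα₀ : coercAy Ω D ≠ 0) (hα : coercAy Ω D ≠ ⊤)
    (hA : coercA Ω K ν ≠ ⊤) {Ca : ℝ} (hformA : IsBoundedForm (formA (Ω := Ω) K ν ybar) Ca)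
    (hν : Continuous (deriv ν)) (hν' : ∀ t, |deriv ν t| ≤ CνT)
    (hF : Continuous (fderiv ℝ F)) (hF' : ∀ z, ‖fderiv ℝ F z‖ ≤ CFy)
    (hubar : divergence ubar = 0) (hMu : ‖ubar‖ ≤ Mu) (hMy : ‖ybar‖ ≤ My)
    (hM : fracNorm (1 / 2 + δ) ubar ≤ M)
    (fhat : StrongDual ℝ (X Ω)) (ftil : StrongDual ℝ (H10v Ω 2)) :
    let α := (coercAy Ω D).toReal
    let A := (coercA Ω K ν).toReal - (convConst Ω).toReal * Mu
    let B := (nuTConst Ω δ CνT M).toReal + CFy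
    let E := (convConst Ω).toReal * My
    (∃! p : X Ω × H10v Ω 2, IsLinearizedSolution K ν F D ubar ybar fhat ftil p.1 p.2) ∧
      ∀ (ψ : X Ω) (χ : H10v Ω 2), IsLinearizedSolution K ν F D ubar ybar fhat ftil ψ χ →
        ‖ψ‖ ≤ max α B / (A * α - B * E) * (‖fhat‖ + ‖ftil‖) ∧
          ‖χ‖ ≤ max E A / (A * α - B * E) * (‖fhat‖ + ‖ftil‖) := by
  intro α A B E
  have hg : IsBoundedForm (fun (ψ : H1v Ω d) s => formC ψ ybar s) E :=
    (isBoundedForm_formC_left hd hC ybar).mono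
      (mul_le_mul_of_nonneg_left hMy ENNReal.toReal_nonneg)
  simp only [isLinearizedSolution_iff]
  exact coupledSystem_wellPosed (U := X Ω) (Y := H10v Ω 2) (ENNReal.toReal_pos hα₀ hα) 
    (by positivity) (by positivity)
    (hsmall.toReal_mul_lt hC hG hα₀ hα hA)
    ((isBoundedForm_momentumForm hC hformA).restrict (X Ω) (X Ω))
    (mul_norm_sq_le_momentumForm hΩ hC hformA hsmall.coercA_ne_zero hubar hMu)
    ((isBoundedForm_couplingForm hd hδ hν hν' hF hF' hG hM).restrict (H10v Ω 2) (X Ω))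
    ((isBoundedForm_transportForm hd hC).restrict (H10v Ω 2) (H10v Ω 2))
    (mul_norm_sq_le_transportForm hΩ hd hC hα₀ hubar)
    (hg.restrict (X Ω) (H10v Ω 2)) fhat ftil

end Linearized

end DoublyDiffusive

theorem mainTheorem7_general {d : ℕ} (hd : 2 ≤ d) {Ω : Set (Pt d)} (hΩne : Ω.Nonempty)
    (hΩo : IsOpen Ω) {i : Fin d} (hΩb : ∃ R, ∀ x ∈ Ω, |x i| ≤ R)
    {K : Pt d → Matrix (Fin d) (Fin d) ℝ}
    (hKm : ∀ i j, AEMeasurable (fun x => K x i j) (volume.restrict Ω))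
    (hKpos : ∃ κ > 0, ∀ x ∈ Ω, ∀ v : Fin d → ℝ, κ * (v ⬝ᵥ v) ≤ v ⬝ᵥ (K x).mulVec v)
    {ν : ℝ → ℝ} {ν₂ : ℝ} (hνb : ∀ t, |ν t| ≤ ν₂) (hν : ContDiff ℝ 1 ν)
    {CνT : ℝ≥0} (hν' : ∀ t, |deriv ν t| ≤ CνT)
    {F : Pt 2 → Pt d} (hF : ContDiff ℝ 1 F) {CFy : ℝ≥0} (hF' : ∀ z, ‖fderiv ℝ F z‖ ≤ CFy)
    {D : Matrix (Fin 2) (Fin 2) ℝ}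
    (hD : ∃ α₂ > 0, ∀ s : Fin 2 → ℝ, α₂ * (s ⬝ᵥ s) ≤ s ⬝ᵥ D.mulVec s)
    {δ : ℝ} (hδ : δ ∈ Set.Ioo (0 : ℝ) (1 / 2)) {Mu My M : ℝ≥0} (hMu : 0 < Mu) (hMy : 0 < My)
    (hsmall : Smallness Ω K ν D δ CνT CFy Mu My M) :
    ∃ Cψ > (0 : ℝ), ∃ Cχ > (0 : ℝ), ∀ (ubar : H1v Ω d) (ybar : H1v Ω 2),
      divergence ubar = 0 → ‖ubar‖ ≤ Mu → ‖ybar‖ ≤ My → fracNorm (1 / 2 + δ) ubar ≤ M →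
      ∀ (fhat : StrongDual ℝ (X Ω)) (ftil : StrongDual ℝ (H10v Ω 2)),
        (∃! p : X Ω × H10v Ω 2, IsLinearizedSolution K ν F D ubar ybar fhat ftil p.1 p.2) ∧
        ∀ (ψ : X Ω) (χ : H10v Ω 2), IsLinearizedSolution K ν F D ubar ybar fhat ftil ψ χ →
          ‖ψ‖ ≤ Cψ * (‖fhat‖ + ‖ftil‖) ∧ ‖χ‖ ≤ Cχ * (‖fhat‖ + ‖ftil‖) := by
  obtain ⟨R, hR⟩ := hΩb
  obtain ⟨κ, hκ, hKpos⟩ := hKpos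
  have hd₀ : d ≠ 0 := by lia
  have := nontrivial_H10v hΩo hΩne hd₀
  have := nontrivial_H10v hΩo hΩne two_ne_zero
  have hα₀ := coercAy_ne_zero hΩo hR hD
  have hα := ne_top_of_mul_enorm_sq_le (coercAy_mul_le (Ω := Ω) D)
  have hA := ne_top_of_mul_enorm_sq_le (coercA_mul_le (Ω := Ω) K ν 0)
  have hC := hsmall.convConst_ne_top hMu
  have hC₀ : convConst Ω ≠ 0 := mul_ne_zero (embConst_ne_zero hΩo hΩne hd₀ (by norm_num))
    (embConst_ne_zero hΩo hΩne hd₀ (by norm_num))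
  have hG := hsmall.nuTConst_ne_top hMy hC₀ hα
  have hlt := hsmall.toReal_mul_lt hC hG hα₀ hα hA
  have hα_pos := ENNReal.toReal_pos hα₀ hα
  have hA_pos := pos_of_mul_pos_left (hlt.trans_le' (by positivity)) hα_pos.le
  refine ⟨_, div_pos
      (lt_max_of_lt_left (c := (nuTConst Ω δ CνT M).toReal + CFy) hα_pos) (sub_pos.2 hlt),
    _, div_pos
      (lt_max_of_lt_right (b := (convConst Ω).toReal * My) hA_pos) (sub_pos.2 hlt), ?_⟩
  intro ubar ybar hubar hu hy hfrac fhat ftil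
  exact linearizedSystem_wellPosed hΩo hd hδ hsmall hC hG hα₀ hα hA
    (isBoundedForm_formA hΩo hKm hκ hKpos hν.continuous hνb ybar)
    (hν.continuous_deriv le_rfl) hν' (hF.continuous_fderiv one_ne_zero) hF'
    hubar hu hy hfrac fhat ftil

theorem mainTheorem7 {d : ℕ} (hd : d = 2 ∨ d = 3)
    -- the bounded Lipschitz domain
    (Ω : Set (Pt d)) (hΩne : Ω.Nonempty) (hΩo : IsOpen Ω) (hΩb : Bornology.IsBounded Ω)
    (hΩL : HasLipschitzBoundary Ω)
    -- the permeability
    (K : Pt d → Matrix (Fin d) (Fin d) ℝ)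
    (hKm : ∀ i j, AEMeasurable (fun x => K x i j) (volume.restrict Ω))
    (hKs : ∀ x ∈ Ω, (K x).IsSymm)
    (hKpos : ∃ κ > 0, ∀ x ∈ Ω, ∀ v : Fin d → ℝ, κ * (v ⬝ᵥ v) ≤ v ⬝ᵥ (K x).mulVec v)
    (hKinv : ∃ α₁ > 0, ∀ x ∈ Ω, ∀ v : Fin d → ℝ, α₁ * (v ⬝ᵥ v) ≤ v ⬝ᵥ ((K x)⁻¹).mulVec v)
    -- the viscosity
    (ν : ℝ → ℝ) (ν₁ ν₂ : ℝ) (hν₁ : 0 < ν₁) (hνb : ∀ t, ν₁ ≤ ν t ∧ ν t ≤ ν₂)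
    (hν : ContDiff ℝ 2 ν) (CνT : ℝ≥0) (hν' : ∀ t, |deriv ν t| ≤ CνT)
    (hν'' : ∃ C : ℝ, ∀ t, |iteratedDeriv 2 ν t| ≤ C)
    -- the buoyancy
    (F : Pt 2 → Pt d) (hF : ContDiff ℝ 2 F) (CFy : ℝ≥0) (hF' : ∀ z, ‖fderiv ℝ F z‖ ≤ CFy)
    (hF'' : ∃ C : ℝ, ∀ z, ‖iteratedFDeriv ℝ 2 F z‖ ≤ C)
    -- the diffusion matrix
    (D : Matrix (Fin 2) (Fin 2) ℝ)
    (hD : ∃ α₂ > 0, ∀ s : Fin 2 → ℝ, α₂ * (s ⬝ᵥ s) ≤ s ⬝ᵥ D.mulVec s)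
    (δ : ℝ) (hδ : δ ∈ Set.Ioo (0 : ℝ) (1 / 2))
    -- the bounds on the states and the smallness condition
    (Mu My M : ℝ≥0) (hMu : 0 < Mu) (hMy : 0 < My) (hM : 0 < M)
    (hsmall : Smallness Ω K ν D δ CνT CFy Mu My M) :
    ∃ Cψ > (0 : ℝ), ∃ Cχ > (0 : ℝ),
      ∀ (ubar : X Ω) (ybar : H1v Ω 2),
        MemFrac (1 / 2 + δ) (ubar : H1v Ω d) → MemFrac (1 / 2 + δ) ybar →
        ‖ubar‖ ≤ Mu → ‖ybar‖ ≤ My →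
        fracNorm (1 / 2 + δ) (ubar : H1v Ω d) + fracNorm (1 / 2 + δ) ybar ≤ M →
        ∀ (fhat : StrongDual ℝ (X Ω)) (ftil : StrongDual ℝ (H10v Ω 2)),
          (∃! p : X Ω × H10v Ω 2,
            IsLinearizedSolution K ν F D (ubar : H1v Ω d) ybar fhat ftil p.1 p.2) ∧
          ∀ (ψ : X Ω) (χ : H10v Ω 2),
            IsLinearizedSolution K ν F D (ubar : H1v Ω d) ybar fhat ftil ψ χ →
              ‖ψ‖ ≤ Cψ * (‖fhat‖ + ‖ftil‖) ∧ ‖χ‖ ≤ Cχ * (‖fhat‖ + ‖ftil‖) := by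
  have hd₂ : 2 ≤ d := by lia
  have hνabs : ∀ t, |ν t| ≤ ν₂ := fun t => by
    rw [abs_of_pos (hν₁.trans_le (hνb t).1)]
    exact (hνb t).2
  exact (mainTheorem7_general hd₂ hΩne hΩo (i := ⟨0, by lia⟩)
    (hΩb.exists_norm_le.imp fun _ hR x hx => (PiLp.norm_apply_le x _).trans (hR x hx)) hKm
    hKpos hνabs (hν.of_le one_le_two) hν' (hF.of_le one_le_two) hF' hD hδ hMu hMy hsmall).imp
    fun _ => And.imp_right (Exists.imp fun _ => And.imp_right
      fun h ubar ybar _ _ hu hy hfrac => h ubar ybar ubar.2.2 hu hy (le_self_add.trans hfrac))
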